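/- Let $(M,g)$ be a non-empty compact smooth Riemannian manifold without boundary, and let $(\xi_1,\varphi_1)$ be a K-contact structure on it: $\xi_1$ is a Killing vector field of unit length such that the endomorphism field $\varphi_1$ defined by $g(\varphi_1\cdot,\cdot)=\tfrac12 d\xi_1(\cdot,\cdot)$ satisfies $\varphi_1^2=-1+\eta_1\otimes\xi_1$, where $\eta_1=g(\xi_1,\cdot)$. Let $\mathfrak{iso}(M)$ be the space of Killing vector fields of $(M,g)$ and put $$\mathfrak g_0=\{A\in\mathfrak{iso}(M):\mathcal L_{\xi_1}A=0\},\qquad \mathfrak g_2=\{A\in\mathfrak{iso}(M):\mathcal L_{\xi_1}\mathcal L_{\xi_1}A=-4A\}.$$ Then $\mathfrak{iso}(M)=\mathfrak g_0\oplus\mathfrak g_2$, and $\mathfrak g_2$ contains a non-zero Killing vector field of constant length if and only if $(M,g)$ admits a weakly K-contact 3-structure $(\xi_1,\xi_2,\xi_3)$ whose first vector field is the given $\xi_1$. Here a *pseudo 3-Sasakian structure* on $M$ consists of a pseudo-Riemannian metric $h$ with Levi-Civita connection $\nabla$ and three pairwise $h$-orthogonal Killing vector fields $\xi_i$ of $h$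 with $h(\xi_i,\xi_i)=-1$, such that $(\nabla_X\nabla\xi_i)(Y)=h(X,Y)\xi_i-h(\xi_i,Y)X$ for all $X,Y$, and such that $\varphi_i^h:=-\nabla\xi_i$ satisfy $\varphi_i^h\varphi_j^h=\varphi_k^h-h(\xi_j,\cdot)\,\xi_i$ and $\varphi_j^h\varphi_i^h=-\varphi_k^h-h(\xi_i,\cdot)\,\xi_j$ for all cyclic permutations $(i,j,k)$ of $(1,2,3)$. (Equivalently, $-h$ and the $\xi_i$ satisfy the usual defining equations of a 3-Sasakian structure.) A *weakly K-contact 3-structure* on $(M,g)$ is a pseudo 3-Sasakian structure $(h,\xi_1,\xi_2,\xi_3)$ on $M$ together with an $h$-orthogonal decomposition $TM=D_+\oplus D_-\oplus V$, where $V=\langle\xi_1,\xi_2,\xi_3\rangle$, $h$ is positive on $D_+$ and negative on $D_-$, and $D_\pm$ are invariant under the vector fields $\xi_i$ (brackets of $\xi_i$ with sections of $D_\pm$ are sections of $D_\pm$) and under the endomorphisms $\varphi_i^h$, such that $g$ is obtained from $h$ by changing its sign on the maximal negative distribution $D_-\oplus V$. -/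

import Mathlib

open Bundle VectorField
open scoped Manifold ContDiff

noncomputable section

namespace KContact

variable {E : Type*} [NormedAddCommGroup E] [NormedSpace ℝ E]
  {M : Type*} [TopologicalSpace M] [ChartedSpace E M] [IsManifold 𝓘(ℝ, E) ∞ M]

variable (E M) in
/-- Smooth vector fields on a (boundaryless) smooth manifold `M` modelled on `E`. -/
abbrev VectorFields : Type _ :=
  ContMDiffSection 𝓘(ℝ, E) E ∞ (fun x : M => TangentSpace 𝓘(ℝ, E) x)

variable (E M) in
/-- Smooth Riemannian metrics on `M`. -/
abbrev RiemannianMetric : Type _ :=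
  ContMDiffRiemannianMetric 𝓘(ℝ, E) ∞ E (fun x : M => TangentSpace 𝓘(ℝ, E) x)

variable (E M) in
/-- Smooth pseudo-Riemannian metrics on `M`: smooth fields of symmetric nondegenerate bilinear
forms on the tangent spaces. -/
structure PseudoRiemannianMetric where
  inner (x : M) : TangentSpace 𝓘(ℝ, E) x →L[ℝ] TangentSpace 𝓘(ℝ, E) x →L[ℝ] ℝ
  symm (x : M) (v w : TangentSpace 𝓘(ℝ, E) x) : inner x v w = inner x w v
  nondegenerate (x : M) (v : TangentSpace 𝓘(ℝ, E) x) (hv : ∀ w, inner x v w = 0) : v = 0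
  contMDiff : ContMDiff 𝓘(ℝ, E) (𝓘(ℝ, E).prod 𝓘(ℝ, E →L[ℝ] E →L[ℝ] ℝ)) ∞
    (fun x ↦ TotalSpace.mk' (E →L[ℝ] E →L[ℝ] ℝ)
      (E := fun x : M => TangentSpace 𝓘(ℝ, E) x →L[ℝ] TangentSpace 𝓘(ℝ, E) x →L[ℝ] ℝ) x (inner x))

/-- The Lie bracket `[X, Y] = L_X Y`, as a plain vector field. -/
abbrev bracket (X Y : Π x : M, TangentSpace 𝓘(ℝ, E) x) : Π x : M, TangentSpace 𝓘(ℝ, E) x :=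
  mlieBracket 𝓘(ℝ, E) X Y

/-- The function `X(f)`, derivative of `f` along the vector field `X`. -/
abbrev derivAlong (X : Π x : M, TangentSpace 𝓘(ℝ, E) x) (f : M → ℝ) (x : M) : ℝ :=
  mvfderiv 𝓘(ℝ, E) f x (X x)

/-- `L_ξ B = 0` for a field `B` of bilinear forms. For `B` a (pseudo-)Riemannian metric this
says that `ξ` is a Killing vector field. -/
def IsKilling (B : Π x : M, TangentSpace 𝓘(ℝ, E) x →L[ℝ] TangentSpace 𝓘(ℝ, E) x →L[ℝ] ℝ)
    (ξ : VectorFields E M) : Prop :=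
  ∀ (Y Z : VectorFields E M) (x : M),
    derivAlong ξ (fun y ↦ B y (Y y) (Z y)) x =
      B x (bracket ξ Y x) (Z x) + B x (Y x) (bracket ξ Z x)

/-- `dη(X, Y) = X(η(Y)) - Y(η(X)) - η([X, Y])` for the one-form `η = g(ξ, ·)`. -/
def dDual (g : RiemannianMetric E M) (ξ X Y : VectorFields E M) (x : M) : ℝ :=
  derivAlong X (fun y ↦ g.inner y (ξ y) (Y y)) x
    - derivAlong Y (fun y ↦ g.inner y (ξ y) (X y)) x
    - g.inner x (ξ x) (bracket X Y x)

/-- `(M, g, ξ, φ)` is a contact metric structure: `ξ` has unit length, `g(φ·,·) = ½ dξ(·,·)`,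
and `φ² = -1 + η ⊗ ξ`. -/
structure IsContactMetric (g : RiemannianMetric E M) (ξ : VectorFields E M)
    (φ : Π x : M, TangentSpace 𝓘(ℝ, E) x →L[ℝ] TangentSpace 𝓘(ℝ, E) x) : Prop where
  unit : ∀ x, g.inner x (ξ x) (ξ x) = 1
  phi : ∀ (X Y : VectorFields E M) (x : M),
    g.inner x (φ x (X x)) (Y x) = (1 / 2 : ℝ) * dDual g ξ X Y x
  phi_sq : ∀ (x : M) (v : TangentSpace 𝓘(ℝ, E) x),
    φ x (φ x v) = -v + g.inner x (ξ x) v • ξ x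

/-- `(M, g, ξ, φ)` is K-contact: a contact metric structure whose vector field is Killing. -/
structure IsKContact (g : RiemannianMetric E M) (ξ : VectorFields E M)
    (φ : Π x : M, TangentSpace 𝓘(ℝ, E) x →L[ℝ] TangentSpace 𝓘(ℝ, E) x) : Prop
    extends IsContactMetric g ξ φ where
  killing : IsKilling g.inner ξ

lemma bracket_zero_right (ξ : Π x : M, TangentSpace 𝓘(ℝ, E) x) :
    bracket ξ (0 : Π x : M, TangentSpace 𝓘(ℝ, E) x) = 0 :=
  mlieBracket_zero_right

lemma mdiff_field (A : VectorFields E M) : MDiff (T% (A : Π x : M, TangentSpace 𝓘(ℝ, E) x)) :=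
  fun x => (A.contMDiff x).mdifferentiableAt (by simp)

section Isometries

variable [FiniteDimensional ℝ E]

lemma bracket_add_right (ξ A B : Π x : M, TangentSpace 𝓘(ℝ, E) x)
    (hA : MDiff (T% A)) (hB : MDiff (T% B)) :
    bracket ξ (A + B) = bracket ξ A + bracket ξ B :=
  haveI := FiniteDimensional.complete ℝ E
  funext fun x => mlieBracket_add_right (hA x) (hB x)

lemma bracket_smul_right (ξ A : Π x : M, TangentSpace 𝓘(ℝ, E) x) (c : ℝ)
    (hA : MDiff (T% A)) : bracket ξ (c • A) = c • bracket ξ A :=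
  haveI := FiniteDimensional.complete ℝ E
  funext fun x => mlieBracket_const_smul_right (hA x)

lemma bracket_add_left (ξ A B : Π x : M, TangentSpace 𝓘(ℝ, E) x)
    (hA : MDiff (T% A)) (hB : MDiff (T% B)) :
    bracket (A + B) ξ = bracket A ξ + bracket B ξ :=
  haveI := FiniteDimensional.complete ℝ E
  funext fun x => mlieBracket_add_left (hA x) (hB x)

lemma bracket_smul_left (ξ A : Π x : M, TangentSpace 𝓘(ℝ, E) x) (c : ℝ)
    (hA : MDiff (T% A)) : bracket (c • A) ξ = c • bracket A ξ :=
  haveI := FiniteDimensional.complete ℝ E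
  funext fun x => mlieBracket_const_smul_left (hA x)

lemma mdiff_bracket (ξ A : VectorFields E M) : MDiff (T% (bracket ξ A)) := fun x => by
  haveI := FiniteDimensional.complete ℝ E
  have h2 : minSmoothness ℝ (2 : WithTop ℕ∞) = 2 := by simp
  haveI : IsManifold 𝓘(ℝ, E) (minSmoothness ℝ 2) M := by rw [h2]; infer_instance
  haveI : IsManifold 𝓘(ℝ, E) (((2 : ℕ∞) : WithTop ℕ∞) + 1) M :=
    IsManifold.of_le (n := ∞) (by exact_mod_cast le_top)
  have h := ContMDiffAt.mlieBracket_vectorField (m := 1) (n := 2)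
    (ξ.contMDiff.contMDiffAt.of_le (x := x) (by exact_mod_cast le_top))
    (A.contMDiff.contMDiffAt.of_le (x := x) (by exact_mod_cast le_top))
    (by simp; norm_num)
  exact h.mdifferentiableAt (by simp)

/-- `𝔦𝔰𝔬(M)`: the space of Killing vector fields of `(M, g)`. -/
def iso (g : RiemannianMetric E M) : Submodule ℝ (VectorFields E M) where
  carrier := {A | IsKilling g.inner A}
  add_mem' {A B} hA hB Y Z x := by
    have h1 := hA Y Z x
    have h2 := hB Y Z x
    simp only [derivAlong, ContMDiffSection.coe_add] at h1 h2 ⊢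
    rw [bracket_add_left _ _ _ (mdiff_field A) (mdiff_field B),
      bracket_add_left _ _ _ (mdiff_field A) (mdiff_field B)]
    simp only [Pi.add_apply, map_add, ContinuousLinearMap.add_apply]
    linear_combination h1 + h2
  zero_mem' Y Z x := by
    simp [derivAlong, bracket]
  smul_mem' c A hA Y Z x := by
    have h1 := hA Y Z x
    simp only [derivAlong, ContMDiffSection.coe_smul] at h1 ⊢
    rw [bracket_smul_left _ _ _ (mdiff_field A), bracket_smul_left _ _ _ (mdiff_field A)]
    simp only [Pi.smul_apply, map_smul, ContinuousLinearMap.smul_apply, smul_eq_mul]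
    linear_combination c * h1

/-- `𝔤₀`: the Killing vector fields `A` with `L_ξ A = 0`. -/
def g₀ (g : RiemannianMetric E M) (ξ : VectorFields E M) : Submodule ℝ (VectorFields E M) where
  carrier := {A | A ∈ iso g ∧ bracket ξ A = 0}
  add_mem' {A B} hA hB := ⟨(iso g).add_mem hA.1 hB.1, by
    rw [ContMDiffSection.coe_add, bracket_add_right _ _ _ (mdiff_field A) (mdiff_field B),
      hA.2, hB.2, add_zero]⟩
  zero_mem' := ⟨(iso g).zero_mem, bracket_zero_right _⟩
  smul_mem' c A hA := ⟨(iso g).smul_mem c hA.1, by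
    rw [ContMDiffSection.coe_smul, bracket_smul_right _ _ _ (mdiff_field A), hA.2, smul_zero]⟩

/-- `𝔤₂`: the Killing vector fields `A` with `L_ξ (L_ξ A) = -4 A`. -/
def g₂ (g : RiemannianMetric E M) (ξ : VectorFields E M) : Submodule ℝ (VectorFields E M) where
  carrier := {A | A ∈ iso g ∧ bracket ξ (bracket ξ A) = (-4 : ℝ) • ⇑A}
  add_mem' {A B} hA hB := ⟨(iso g).add_mem hA.1 hB.1, by
    rw [ContMDiffSection.coe_add, bracket_add_right _ _ _ (mdiff_field A) (mdiff_field B),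
      bracket_add_right _ _ _ (mdiff_bracket ξ A) (mdiff_bracket ξ B), hA.2, hB.2, smul_add]⟩
  zero_mem' := ⟨(iso g).zero_mem, by
    rw [ContMDiffSection.coe_zero, bracket_zero_right, bracket_zero_right, smul_zero]⟩
  smul_mem' c A hA := ⟨(iso g).smul_mem c hA.1, by
    rw [ContMDiffSection.coe_smul, bracket_smul_right _ _ _ (mdiff_field A),
      bracket_smul_right _ _ _ (mdiff_bracket ξ A), hA.2, smul_comm]⟩

end Isometries

/-- The vector field `A` has constant length with respect to `g`. -/
def HasConstantLength (g : RiemannianMetric E M) (A : VectorFields E M) : Prop :=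
  ∃ c : ℝ, ∀ x, g.inner x (A x) (A x) = c

variable (E M) in
/-- Affine connections on `M`; `cov Y x v` is `∇_v Y`. -/
abbrev Connection : Type _ :=
  CovariantDerivative 𝓘(ℝ, E) E (fun x : M => TangentSpace 𝓘(ℝ, E) x)

/-- `cov` is the Levi-Civita connection of `h`: torsion-free and metric. -/
structure IsLeviCivita (h : PseudoRiemannianMetric E M) (cov : Connection E M) : Prop where
  torsion_free : ∀ (X Y : Π x : M, TangentSpace 𝓘(ℝ, E) x) (x : M),
    MDiffAt (T% X) x → MDiffAt (T% Y) x →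
      cov Y x (X x) - cov X x (Y x) = bracket X Y x
  metric : ∀ (X Y Z : Π x : M, TangentSpace 𝓘(ℝ, E) x) (x : M),
    MDiffAt (T% X) x → MDiffAt (T% Y) x → MDiffAt (T% Z) x →
      derivAlong X (fun y ↦ h.inner y (Y y) (Z y)) x =
        h.inner x (cov Y x (X x)) (Z x) + h.inner x (Y x) (cov Z x (X x))

/-- The endomorphism field `φ = -∇ξ`. -/
def phi (cov : Connection E M) (ξ : VectorFields E M) (x : M) :
    TangentSpace 𝓘(ℝ, E) x →L[ℝ] TangentSpace 𝓘(ℝ, E) x :=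
  -cov ξ x

/-- `ξ` is a time-like Sasakian vector field of `(M, h)`, with Levi-Civita connection `cov`:
a Killing vector field with `h(ξ, ξ) = -1` and
`(∇_X ∇ξ)(Y) = ∇_X ∇_Y ξ - ∇_{∇_X Y} ξ = h(X, Y) ξ - h(ξ, Y) X`.
In terms of `k = -h`, which has the same connection and for which `ξ` is a unit vector, this is the
usual Sasakian equation `(∇_X ∇ξ)(Y) = k(ξ, Y) X - k(X, Y) ξ`. -/
structure IsTimelikeSasakian (h : PseudoRiemannianMetric E M) (cov : Connection E M)
    (ξ : VectorFields E M) : Prop where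
  killing : IsKilling h.inner ξ
  timelike : ∀ x, h.inner x (ξ x) (ξ x) = -1
  sasaki : ∀ (X Y : VectorFields E M) (x : M),
    cov (fun y ↦ cov ξ y (Y y)) x (X x) - cov ξ x (cov Y x (X x)) =
      h.inner x (X x) (Y x) • ξ x - h.inner x (ξ x) (Y x) • X x

/-- `(ξ 0, ξ 1, ξ 2)` is a pseudo 3-Sasakian structure on `(M, h)`, with Levi-Civita connection
`cov`: three pairwise orthogonal time-like Sasakian vector fields such that `φ i = -∇(ξ i)`
satisfy, for `(i, j, k)` a cyclic permutation of `(0, 1, 2)`,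
`φ i ∘ φ j = φ k + k(ξ j, ·) ξ i` and `φ j ∘ φ i = -φ k + k(ξ i, ·) ξ j`, where `k = -h`
(addition in `Fin 3` is modulo `3`). -/
structure IsPseudoThreeSasakian (h : PseudoRiemannianMetric E M) (cov : Connection E M)
    (ξ : Fin 3 → VectorFields E M) : Prop where
  leviCivita : IsLeviCivita h cov
  sasakian : ∀ i, IsTimelikeSasakian h cov (ξ i)
  orthogonal : ∀ i j, i ≠ j → ∀ x, h.inner x (ξ i x) (ξ j x) = 0
  phi_comp : ∀ (i : Fin 3) (x : M) (v : TangentSpace 𝓘(ℝ, E) x),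
    phi cov (ξ i) x (phi cov (ξ (i + 1)) x v) =
      phi cov (ξ (i + 2)) x v - h.inner x (ξ (i + 1) x) v • ξ i x
  phi_comp_swap : ∀ (i : Fin 3) (x : M) (v : TangentSpace 𝓘(ℝ, E) x),
    phi cov (ξ (i + 1)) x (phi cov (ξ i) x v) =
      -phi cov (ξ (i + 2)) x v - h.inner x (ξ i x) v • ξ (i + 1) x

/-- The distribution `V` spanned by the three vector fields. -/
def vertical (ξ : Fin 3 → VectorFields E M) (x : M) : Submodule ℝ (TangentSpace 𝓘(ℝ, E) x) :=
  Submodule.span ℝ (Set.range fun i => ξ i x)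

/-- The distribution `D` is invariant under the vector fields `ξ i`: the bracket of `ξ i` with a
section of `D` is a section of `D`. -/
def IsInvariantUnder (ξ : Fin 3 → VectorFields E M)
    (D : Π x : M, Submodule ℝ (TangentSpace 𝓘(ℝ, E) x)) : Prop :=
  ∀ (i : Fin 3) (X : VectorFields E M), (∀ x, X x ∈ D x) → ∀ x, bracket (ξ i) X x ∈ D x

/-- A weakly K-contact 3-structure on the Riemannian manifold `(M, g)`: the metric `g` is obtained
from a pseudo 3-Sasakian structure `(h, ξ)` and an `h`-orthogonal decomposition
`TM = D₊ ⊕ D₋ ⊕ V`, with `h` positive on `D₊` and negative on `D₋`, with `D₊` and `D₋` invariant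
under the vector fields `ξ i` and the endomorphisms `φ i`, by changing the sign of `h` on the
maximal negative distribution `D₋ ⊕ V`.
Directness of the sum follows from orthogonality and the signs; smoothness of `D₊` and `D₋` follows
from that of `g` and `h`, since `D₊` and `D₋ ⊕ V` are the eigenbundles of `g⁻¹ h`. -/
structure WeaklyKContactThreeStructure (g : RiemannianMetric E M) where
  ξ : Fin 3 → VectorFields E M
  h : PseudoRiemannianMetric E M
  cov : Connection E M
  pseudoThreeSasakian : IsPseudoThreeSasakian h cov ξ
  Dpos : Π x : M, Submodule ℝ (TangentSpace 𝓘(ℝ, E) x)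
  Dneg : Π x : M, Submodule ℝ (TangentSpace 𝓘(ℝ, E) x)
  span : ∀ x, Dpos x ⊔ Dneg x ⊔ vertical ξ x = ⊤
  orthogonal : ∀ x, ∀ v ∈ Dpos x, ∀ w ∈ Dneg x, h.inner x v w = 0
  orthogonal_pos : ∀ x, ∀ v ∈ Dpos x, ∀ w ∈ vertical ξ x, h.inner x v w = 0
  orthogonal_neg : ∀ x, ∀ v ∈ Dneg x, ∀ w ∈ vertical ξ x, h.inner x v w = 0
  pos : ∀ x, ∀ v ∈ Dpos x, v ≠ 0 → 0 < h.inner x v v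
  neg : ∀ x, ∀ v ∈ Dneg x, v ≠ 0 → h.inner x v v < 0
  invariant_pos : IsInvariantUnder ξ Dpos
  invariant_neg : IsInvariantUnder ξ Dneg
  phi_pos : ∀ i x, ∀ v ∈ Dpos x, phi cov (ξ i) x v ∈ Dpos x
  phi_neg : ∀ i x, ∀ v ∈ Dneg x, phi cov (ξ i) x v ∈ Dneg x
  metric_pos : ∀ x, ∀ v ∈ Dpos x, ∀ w, g.inner x v w = h.inner x v w
  metric_neg : ∀ x, ∀ v ∈ Dneg x ⊔ vertical ξ x, ∀ w, g.inner x v w = -h.inner x v w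

end KContact

end

/-!
Throughout, `η = g(ξ, ·)`, and the covariant derivative of a Killing field `ξ` is the skew-symmetric
endomorphism field determined by `dη`; the flow of a Killing field preserves the Levi-Civita
connection.

*Splitting of the Killing fields.* If `A` is a Killing field orthogonal to `ξ`, then
`L_ξ A = -2 ∇_A ξ`. By the K-contact condition `(∇ξ)² = -1` on the orthogonal complement of `ξ`,
whence `L_ξ² A = -4 A` (`IsKilling.lie_lie_of_orthogonal`). For any Killing field `A` the field
`L_ξ A` is orthogonal to `ξ`, so `L_ξ (L_ξ² + 4) = 0` on Killing fields, and these split into the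
kernels of `L_ξ` and of `L_ξ² + 4`.

*From a Killing field to a 3-structure.* A unit length field `A` in `𝔤₂` is orthogonal to `ξ`, and
`ξ`, `A`, `½ L_ξ A` are orthonormal Killing fields `ξ₀, ξ₁, ξ₂` with the brackets of `𝔰𝔲(2)`
(`IsKContact.exists_isKillingTriple`). Differentiating `(∇ξ₀)² = -1 + η₀ ⊗ ξ₀` along `ξ₁` yields the
same identity for the other two fields and the anticommutation of the three endomorphisms modulo
vertical terms (`IsKillingTriple.sq_and_anticomm_of_sq`). On the common orthogonal complement the
`∇ξ_i` are thus anticommuting complex structures, and `-∇ξ₀ ∘ ∇ξ₁ ∘ ∇ξ₂` is a `g`-symmetric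
involution commuting with them. Extended by `-1` on the vertical bundle, it is an involution `τ`
invariant under the three flows (`IsKillingTriple.involution_involution`,
`IsKillingTriple.lie_involutionField`). The `ξ_i` are Killing for the pseudo-Riemannian metric
`h = g(τ ·, ·)`, and the endomorphisms `φ_i = τ ∘ ∇ξ_i` belonging to `h` satisfy the quaternionic
relations. The eigenbundles of `τ` give the decomposition of the tangent bundle.

The Sasakian equations for `h` follow from the quaternionic relations, as in Kashiwada's theorem for
Riemannian metrics (`IsContactTriple.isPseudoThreeSasakian`): the failure of these equations defines
three tensors, killed by the vertical fields, which satisfy the identities used in Hitchin's lemma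
on hyperkähler structures, and these identities imply vanishing (`quaternionic_eq_zero`).

*From a 3-structure to a Killing field.* The relations between the `φ_i` give
`[ξ_i, ξ_{i+1}] = 2 ξ_{i+2}`, so that `L_ξ² ξ₁ = -4 ξ₁` for `ξ = ξ₀`. The field `ξ₁` has unit length
for `g`, and it is Killing for `g` since it is Killing for `h` and preserves both `D₊` and
`D₋ ⊕ V` (`WeaklyKContactThreeStructure.killing`).
-/

noncomputable section

namespace KContact

set_option linter.unusedSectionVars false

variable {E : Type*} [NormedAddCommGroup E] [NormedSpace ℝ E]
  {M : Type*} [TopologicalSpace M] [ChartedSpace E M] [IsManifold 𝓘(ℝ, E) ∞ M]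

/-! ### Smooth functions and smooth vector fields -/

variable (E M) in
/-- Smooth real-valued functions on `M`. -/
abbrev Functions : Type _ := C^∞⟮𝓘(ℝ, E), M; ℝ⟯

/-- The function `x ↦ h(X, Y)(x)`, for smooth vector fields `X` and `Y`. -/
def PseudoRiemannianMetric.pair (h : PseudoRiemannianMetric E M) (X Y : VectorFields E M) :
    Functions E M :=
  ⟨fun x ↦ h.inner x (X x) (Y x), by
    have := ContMDiff.clm_bundle_apply₂ (F₁ := E) (F₂ := E) (F₃ := ℝ)
      (E₁ := fun x : M => TangentSpace 𝓘(ℝ, E) x) (E₂ := fun x : M => TangentSpace 𝓘(ℝ, E) x)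
      (E₃ := Bundle.Trivial M ℝ) (ψ := h.inner) (b := fun x : M => x)
      h.contMDiff X.contMDiff Y.contMDiff
    intro x
    have := this x
    rw [contMDiffAt_totalSpace] at this
    exact this.2⟩

@[simp]
lemma PseudoRiemannianMetric.pair_apply (h : PseudoRiemannianMetric E M) (X Y : VectorFields E M)
    (x : M) : h.pair X Y x = h.inner x (X x) (Y x) := rfl

/-- A Riemannian metric, seen as a pseudo-Riemannian metric. -/
def RiemannianMetric.toPseudo (g : RiemannianMetric E M) : PseudoRiemannianMetric E M where
  inner := g.inner
  symm := g.symm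
  nondegenerate x v hv := by
    by_contra h
    exact (g.pos x v h).ne' (hv v)
  contMDiff := g.contMDiff

lemma Functions.mdiffAt (f : Functions E M) (x : M) : MDiffAt f x :=
  (f.contMDiff x).mdifferentiableAt (by simp)

lemma contMDiff_det {ι : Type*} [Fintype ι] [DecidableEq ι] {A : M → Matrix ι ι ℝ} {x : M}
    (hA : ∀ i j, CMDiffAt ∞ (fun y ↦ A y i j) x) :
    CMDiffAt ∞ (fun y ↦ (A y).det) x := by
  simp only [Matrix.det_apply']
  exact contMDiffAt_finsetSum fun σ _ ↦ contMDiffAt_const.mul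
    (contMDiffAt_finsetProd fun i _ ↦ hA _ _)

section Extension

variable [FiniteDimensional ℝ E] [T2Space M]

/-- Every local smooth section agrees near a given point with a global one. -/
lemma exists_vectorField_eventuallyEq {x : M} {u : Set M} (hu : IsOpen u) (hx : x ∈ u)
    {s : Π y : M, TangentSpace 𝓘(ℝ, E) y} (hs : CMDiff[u] ∞ (T% s)) :
    ∃ X : VectorFields E M, ∀ᶠ y in nhds x, X y = s y := by
  obtain ⟨ψ, -, hψ⟩ := (SmoothBumpFunction.nhds_basis_tsupport (I := 𝓘(ℝ, E)) x).mem_iff.1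
    (hu.mem_nhds hx)
  refine ⟨⟨(ψ : M → ℝ) • s, ContMDiffOn.smul_section_of_tsupport ψ.contMDiff.contMDiffOn hu hψ hs⟩,
    ?_⟩
  filter_upwards [ψ.eventuallyEq_one] with y hy
  simp [hy]

/-- Every tangent vector is the value of a global smooth vector field. -/
lemma exists_vectorField (x : M) (v : TangentSpace 𝓘(ℝ, E) x) :
    ∃ X : VectorFields E M, X x = v := by
  obtain ⟨u, hu, hs⟩ := FiberBundle.exists_contMDiffOn_extend (k := ∞) 𝓘(ℝ, E) E v
  obtain ⟨w, hwu, hw, hxw⟩ := mem_nhds_iff.1 hu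
  obtain ⟨X, hX⟩ := exists_vectorField_eventuallyEq hw hxw (hs.mono hwu)
  exact ⟨X, by simpa using hX.self_of_nhds⟩

lemma exists_localFrame (x : M) : ∃ X : Fin (Module.finrank ℝ E) → VectorFields E M,
    ∃ u : Set M, IsOpen u ∧ x ∈ u ∧ IsLocalFrameOn 𝓘(ℝ, E) E ∞ (fun i y ↦ X i y) u := by
  let e := trivializationAt E (TangentSpace 𝓘(ℝ, E)) x
  let b := Module.finBasis ℝ E
  have hxe : x ∈ e.baseSet := FiberBundle.mem_baseSet_trivializationAt' x
  choose X hX using fun i ↦ exists_vectorField_eventuallyEq e.open_baseSet hxe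
    (e.contMDiffOn_localFrame_baseSet (I := 𝓘(ℝ, E)) ∞ b i)
  obtain ⟨u, hu, huo, hxu⟩ := eventually_nhds_iff.1
    ((Filter.eventually_all.2 hX).and (e.open_baseSet.mem_nhds hxe))
  refine ⟨X, u, huo, hxu, ?_⟩
  have H := (e.isLocalFrameOn_localFrame_baseSet 𝓘(ℝ, E) ∞ b)
  refine ⟨fun {y} hy ↦ ?_, fun {y} hy ↦ ?_, fun i ↦ (X i).contMDiff.contMDiffOn⟩
  · rw [show (fun i ↦ X i y) = fun i ↦ e.localFrame b i y from funext (hu y hy).1]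
    exact H.linearIndependent (hu y hy).2
  · rw [show (fun i ↦ X i y) = fun i ↦ e.localFrame b i y from funext (hu y hy).1]
    exact H.generating (hu y hy).2

/-- A vector field is smooth as soon as its products with all smooth vector fields, for some
pseudo-Riemannian metric, are smooth functions: its coefficients in a local frame are given by
Cramer's rule. -/
lemma contMDiff_of_inner (h : PseudoRiemannianMetric E M) (v : Π x : M, TangentSpace 𝓘(ℝ, E) x)
    (hv : ∀ Y : VectorFields E M, CMDiff ∞ (fun x ↦ h.inner x (v x) (Y x))) :
    CMDiff ∞ (T% v) := by
  classical
  intro x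
  obtain ⟨X, u, huo, hxu, hX⟩ := exists_localFrame (E := E) x
  refine hX.contMDiffAt_of_coeff (fun i ↦ ?_) (huo.mem_nhds hxu)
  let G : M → Matrix (Fin (Module.finrank ℝ E)) (Fin (Module.finrank ℝ E)) ℝ :=
    fun y ↦ .of fun j k ↦ h.inner y (X k y) (X j y)
  let α : M → Fin (Module.finrank ℝ E) → ℝ := fun y j ↦ h.inner y (v y) (X j y)
  let c : M → Fin (Module.finrank ℝ E) → ℝ := fun y j ↦ hX.coeff j y (v y)
  have hG (j k) (y) : CMDiffAt ∞ (fun y ↦ G y j k) y := (h.pair (X k) (X j)).contMDiff y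
  have hc {y} (hy : y ∈ u) : (G y).mulVec (c y) = α y := by
    ext j
    have := hX.coeff_sum_eq v hy
    simp only [α, Matrix.mulVec, dotProduct, G, c, Matrix.of_apply]
    conv_rhs => rw [this]
    simp [mul_comm]
  have hdet {y} (hy : y ∈ u) : (G y).det ≠ 0 := by
    intro h0
    obtain ⟨w, hw, hGw⟩ := Matrix.exists_mulVec_eq_zero_iff.2 h0
    have hz : ∑ k, w k • X k y = 0 := by
      refine h.nondegenerate y _ fun z ↦ ?_
      have hz := congrArg (h.inner y (∑ k, w k • X k y))
        ((hX.toBasisAt hy).sum_repr z)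
      rw [← hz, map_sum]
      refine Finset.sum_eq_zero fun j _ ↦ ?_
      have := congrFun hGw j
      simp only [Matrix.mulVec, dotProduct, G, Matrix.of_apply, Pi.zero_apply] at this
      simp only [map_smul, map_sum, hX.toBasisAt_coe, smul_eq_mul, sum_apply, smul_apply]
      simp only [mul_comm (w _), this, mul_zero]
    exact hw (funext fun k ↦ Fintype.linearIndependent_iff.1 (hX.linearIndependent hy) w hz k)
  have key : (fun y ↦ ((G y).updateCol i (α y)).det / (G y).det) =ᶠ[nhds x] fun y ↦ c y i := by
    filter_upwards [huo.mem_nhds hxu] with y hy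
    rw [div_eq_iff (hdet hy), ← Matrix.cramer_apply, ← hc hy, Matrix.cramer_eq_adjugate_mulVec,
      Matrix.mulVec_mulVec, Matrix.adjugate_mul, Matrix.smul_mulVec, Matrix.one_mulVec]
    simp [mul_comm]
  refine ContMDiffAt.congr_of_eventuallyEq ?_ key.symm
  refine ContMDiffAt.div₀ (contMDiff_det fun j k ↦ ?_) (contMDiff_det fun j k ↦ hG j k x) (hdet hxu)
  simp only [Matrix.updateCol_apply]
  split_ifs
  · exact hv _ x
  · exact hG j k x

/-- The smooth vector field underlying a vector field with smooth products. -/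
def ofInner (h : PseudoRiemannianMetric E M) (v : Π x : M, TangentSpace 𝓘(ℝ, E) x)
    (hv : ∀ Y : VectorFields E M, CMDiff ∞ (fun x ↦ h.inner x (v x) (Y x))) :
    VectorFields E M := ⟨v, contMDiff_of_inner h v hv⟩

lemma contMDiffAt_of_clm_apply {F : Type*} [NormedAddCommGroup F] [NormedSpace ℝ F]
    {A : M → E →L[ℝ] F} {x : M} (hA : ∀ e, CMDiffAt ∞ (fun y ↦ A y e) x) : CMDiffAt ∞ A x := by
  let b := Module.finBasis ℝ E
  have : A = fun y ↦ ∑ i, ContinuousLinearMap.smulRightL ℝ E F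
      (LinearMap.toContinuousLinearMap (b.coord i)) (A y (b i)) := by
    ext y e
    conv_lhs => rw [← b.sum_repr e]
    simp [-Module.Basis.sum_repr, map_sum]
  rw [this]
  exact contMDiffAt_finsetSum fun i _ ↦
    (ContinuousLinearMap.contMDiff _).contMDiffAt.comp x (hA (b i))

/-- A field of bilinear forms is smooth as soon as its values on smooth vector fields are smooth
functions. -/
lemma contMDiff_of_apply₂
    (B : Π x : M, TangentSpace 𝓘(ℝ, E) x →L[ℝ] TangentSpace 𝓘(ℝ, E) x →L[ℝ] ℝ)
    (hB : ∀ X Y : VectorFields E M, CMDiff ∞ (fun x ↦ B x (X x) (Y x))) :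
    ContMDiff 𝓘(ℝ, E) (𝓘(ℝ, E).prod 𝓘(ℝ, E →L[ℝ] E →L[ℝ] ℝ)) ∞
    (fun x ↦ TotalSpace.mk' (E →L[ℝ] E →L[ℝ] ℝ)
      (E := fun x : M => TangentSpace 𝓘(ℝ, E) x →L[ℝ] TangentSpace 𝓘(ℝ, E) x →L[ℝ] ℝ) x (B x)) := by
  intro x
  rw [contMDiffAt_hom_bundle]
  refine ⟨contMDiffAt_id, contMDiffAt_of_clm_apply fun e₁ ↦ contMDiffAt_of_clm_apply fun e₂ ↦ ?_⟩
  let t := trivializationAt E (TangentSpace 𝓘(ℝ, E)) x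
  have hxt : x ∈ t.baseSet := FiberBundle.mem_baseSet_trivializationAt' x
  have hs (e : E) : ∃ X : VectorFields E M, ∀ᶠ y in nhds x, X y = t.symm y e := by
    refine exists_vectorField_eventuallyEq t.open_baseSet hxt ?_
    rw [t.contMDiffOn_section_baseSet_iff]
    refine (contMDiffOn_const (c := e)).congr fun y hy ↦ ?_
    simp [hy]
  obtain ⟨X, hX⟩ := hs e₁
  obtain ⟨Y, hY⟩ := hs e₂
  refine ContMDiffAt.congr_of_eventuallyEq (hB X Y x) ?_
  filter_upwards [hX, hY, t.open_baseSet.mem_nhds hxt] with y h1 h2 hy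
  rw [inCoordinates_apply_eq₂ hy hy (Set.mem_univ _), h1, h2]
  simp [t]

end Extension

/-! ### The Levi-Civita connection of a pseudo-Riemannian metric -/

section LeviCivita

variable [FiniteDimensional ℝ E]

lemma PseudoRiemannianMetric.mdiffAt_inner (h : PseudoRiemannianMetric E M)
    {X Y : Π x : M, TangentSpace 𝓘(ℝ, E) x} {x : M} (hX : MDiffAt (T% X) x)
    (hY : MDiffAt (T% Y) x) : MDiffAt (fun y ↦ h.inner y (X y) (Y y)) x := by
  have := MDifferentiableAt.clm_bundle_apply₂ (F₁ := E) (F₂ := E) (F₃ := ℝ)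
      (E₁ := fun x : M => TangentSpace 𝓘(ℝ, E) x) (E₂ := fun x : M => TangentSpace 𝓘(ℝ, E) x)
      (E₃ := Bundle.Trivial M ℝ) (ψ := h.inner) (b := fun x : M => x)
      ((h.contMDiff x).mdifferentiableAt (by simp)) hX hY
  rw [mdifferentiableAt_totalSpace] at this
  exact this.2

/-- The right-hand side of the Koszul formula for `h(∇_X Y, Z)`. -/
def koszul (h : PseudoRiemannianMetric E M) (Y X Z : Π x : M, TangentSpace 𝓘(ℝ, E) x) (x : M) :
    ℝ :=
  (1 / 2 : ℝ) * (derivAlong X (fun y ↦ h.inner y (Y y) (Z y)) x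
    + derivAlong Y (fun y ↦ h.inner y (X y) (Z y)) x
    - derivAlong Z (fun y ↦ h.inner y (X y) (Y y)) x
    + h.inner x (bracket X Y x) (Z x) - h.inner x (bracket X Z x) (Y x)
    - h.inner x (bracket Y Z x) (X x))

variable (h : PseudoRiemannianMetric E M) {X Y Z : Π x : M, TangentSpace 𝓘(ℝ, E) x} {x : M}

lemma koszul_tensorial_left (hY : MDiffAt (T% Y) x) (hZ : MDiffAt (T% Z) x) :
    TensorialAt 𝓘(ℝ, E) E (fun X ↦ koszul h Y X Z x) x := by
  have := FiniteDimensional.complete ℝ E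
  refine ⟨fun {f X} hf hX ↦ ?_, fun {X X'} hX hX' ↦ ?_⟩
  · simp only [koszul, bracket, derivAlong, Pi.smul_apply', map_smul, smul_apply, smul_eq_mul]
    rw [mvfderiv_fun_mul hf (h.mdiffAt_inner hX hZ), mvfderiv_fun_mul hf (h.mdiffAt_inner hX hY),
      mlieBracket_smul_left hf hX, mlieBracket_smul_left hf hX]
    simp only [map_add, map_smul, smul_apply, add_apply, smul_eq_mul]
    ring
  · simp only [koszul, bracket, derivAlong, Pi.add_apply, map_add, add_apply]
    rw [mvfderiv_fun_add (h.mdiffAt_inner hX hZ) (h.mdiffAt_inner hX' hZ),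
      mvfderiv_fun_add (h.mdiffAt_inner hX hY) (h.mdiffAt_inner hX' hY),
      mlieBracket_add_left hX hX', mlieBracket_add_left hX hX']
    simp only [map_add, add_apply]
    ring

lemma koszul_tensorial_right (hY : MDiffAt (T% Y) x) (hX : MDiffAt (T% X) x) :
    TensorialAt 𝓘(ℝ, E) E (fun Z ↦ koszul h Y X Z x) x := by
  have := FiniteDimensional.complete ℝ E
  refine ⟨fun {f Z} hf hZ ↦ ?_, fun {Z Z'} hZ hZ' ↦ ?_⟩
  · simp only [koszul, bracket, derivAlong, Pi.smul_apply', map_smul, smul_eq_mul]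
    rw [mvfderiv_fun_mul hf (h.mdiffAt_inner hX hZ), mvfderiv_fun_mul hf (h.mdiffAt_inner hY hZ),
      mlieBracket_smul_right hf hZ, mlieBracket_smul_right hf hZ]
    simp only [map_add, map_smul, smul_apply, add_apply, smul_eq_mul]
    rw [h.symm x (Z x) (X x), h.symm x (Z x) (Y x)]
    ring
  · simp only [koszul, bracket, derivAlong, Pi.add_apply, map_add]
    rw [mvfderiv_fun_add (h.mdiffAt_inner hY hZ) (h.mdiffAt_inner hY hZ'),
      mvfderiv_fun_add (h.mdiffAt_inner hX hZ) (h.mdiffAt_inner hX hZ'),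
      mlieBracket_add_right hZ hZ', mlieBracket_add_right hZ hZ']
    simp only [map_add, add_apply]
    ring

lemma koszul_add (hX : MDiffAt (T% X) x) (hZ : MDiffAt (T% Z) x)
    {Y' : Π x : M, TangentSpace 𝓘(ℝ, E) x} (hY : MDiffAt (T% Y) x) (hY' : MDiffAt (T% Y') x) :
    koszul h (Y + Y') X Z x = koszul h Y X Z x + koszul h Y' X Z x := by
  have := FiniteDimensional.complete ℝ E
  simp only [koszul, bracket, derivAlong, Pi.add_apply, map_add, add_apply]
  rw [mvfderiv_fun_add (h.mdiffAt_inner hY hZ) (h.mdiffAt_inner hY' hZ),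
    mvfderiv_fun_add (h.mdiffAt_inner hX hY) (h.mdiffAt_inner hX hY'),
    mlieBracket_add_left hY hY', mlieBracket_add_right hY hY']
  simp only [map_add, add_apply]
  ring

lemma koszul_smul (hX : MDiffAt (T% X) x) (hZ : MDiffAt (T% Z) x)
    {f : M → ℝ} (hf : MDiffAt f x) (hY : MDiffAt (T% Y) x) :
    koszul h (f • Y) X Z x =
      f x * koszul h Y X Z x + derivAlong X f x * h.inner x (Y x) (Z x) := by
  have := FiniteDimensional.complete ℝ E
  simp only [koszul, bracket, derivAlong, Pi.smul_apply', map_smul, smul_apply, smul_eq_mul]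
  rw [mvfderiv_fun_mul hf (h.mdiffAt_inner hY hZ), mvfderiv_fun_mul hf (h.mdiffAt_inner hX hY),
    mlieBracket_smul_left hf hY, mlieBracket_smul_right hf hY]
  simp only [map_add, map_smul, smul_apply, add_apply, smul_eq_mul]
  rw [h.symm x (Y x) (X x)]
  ring

/-- Raising an index with a nondegenerate bilinear form. -/
lemma exists_clm_of_nondegenerate (B K : E →L[ℝ] E →L[ℝ] ℝ)
    (hs : ∀ v w, B v w = B w v) (hB : ∀ v, (∀ w, B v w = 0) → v = 0) :
    ∃ A : E →L[ℝ] E, ∀ v w, B (A v) w = K v w := by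
  have hB' : (B.toLinearMap₁₂).Nondegenerate :=
    ⟨fun v hv ↦ hB v hv, fun v hv ↦ hB v fun w ↦ by rw [hs]; exact hv w⟩
  let e := LinearMap.BilinForm.toDual (B.toLinearMap₁₂) hB'
  refine ⟨LinearMap.toContinuousLinearMap (e.symm.toLinearMap ∘ₗ K.toLinearMap₁₂), fun v w ↦ ?_⟩
  exact LinearMap.BilinForm.apply_toDual_symm_apply (B := B.toLinearMap₁₂) (hB := hB')
    (K.toLinearMap₁₂ v) w

/-- The endomorphism `∇Y` at `x`. For fields `Y` that are not differentiable at `x` nothing is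
required of it, so that a choice is defined for all `Y`. -/
lemma exists_koszul (Y : Π x : M, TangentSpace 𝓘(ℝ, E) x) (x : M) :
    ∃ A : TangentSpace 𝓘(ℝ, E) x →L[ℝ] TangentSpace 𝓘(ℝ, E) x, MDiffAt (T% Y) x →
      ∀ X Z : Π x : M, TangentSpace 𝓘(ℝ, E) x, MDiffAt (T% X) x → MDiffAt (T% Z) x →
      h.inner x (A (X x)) (Z x) = koszul h Y X Z x := by
  by_cases hY : MDiffAt (T% Y) x
  · obtain ⟨A, hA⟩ := exists_clm_of_nondegenerate (E := E) (h.inner x)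
      (TensorialAt.mkHom₂ (I := 𝓘(ℝ, E)) (F := E) (F' := E) (fun X Z ↦ koszul h Y X Z x) x
        (fun Z hZ ↦ koszul_tensorial_left h hY hZ) (fun X hX ↦ koszul_tensorial_right h hY hX))
      (h.symm x) (h.nondegenerate x)
    exact ⟨A, fun _ X Z hX hZ ↦ (hA (X x) (Z x)).trans (TensorialAt.mkHom₂_apply _ _ hX hZ)⟩
  · exact ⟨0, fun hY' ↦ (hY hY').elim⟩

/-- Two tangent vectors with the same products with the values of differentiable fields agree. -/
lemma eq_of_inner_eq {v w : TangentSpace 𝓘(ℝ, E) x}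
    (hvw : ∀ Z : Π x : M, TangentSpace 𝓘(ℝ, E) x, MDiffAt (T% Z) x →
      h.inner x v (Z x) = h.inner x w (Z x)) : v = w := by
  refine sub_eq_zero.1 (h.nondegenerate x _ fun z ↦ ?_)
  have := hvw _ (FiberBundle.mdifferentiableAt_extend 𝓘(ℝ, E) E z)
  simp only [FiberBundle.extend_apply_self] at this
  simp [this]

/-- The Levi-Civita connection of `h`, given by the Koszul formula. -/
def leviCivita : Connection E M where
  toFun Y x := (exists_koszul h Y x).choose
  isCovariantDerivativeOnUniv := by
    have spec (Y : Π x : M, TangentSpace 𝓘(ℝ, E) x) (x : M) := (exists_koszul h Y x).choose_spec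
    refine ⟨fun {Y Y' x} hY hY' _ ↦ ?_, fun {Y f x} hY hf _ ↦ ?_⟩
    all_goals
      ext v
      have hv := FiberBundle.mdifferentiableAt_extend 𝓘(ℝ, E) E v
      rw [← FiberBundle.extend_apply_self E v]
      refine eq_of_inner_eq h fun Z hZ ↦ ?_
    · rw [spec _ x (mdifferentiableAt_add_section hY hY') _ Z hv hZ, koszul_add h hv hZ hY hY',
        add_apply, map_add, add_apply, spec Y x hY _ Z hv hZ, spec Y' x hY' _ Z hv hZ]
    · rw [spec _ x (hf.smul_section hY) _ Z hv hZ, koszul_smul h hv hZ hf hY]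
      simp only [add_apply, map_add, smul_apply, map_smul, spec Y x hY _ Z hv hZ,
        ContinuousLinearMap.smulRight_apply, smul_eq_mul]

lemma inner_leviCivita (hX : MDiffAt (T% X) x) (hY : MDiffAt (T% Y) x) (hZ : MDiffAt (T% Z) x) :
    h.inner x (leviCivita h Y x (X x)) (Z x) = koszul h Y X Z x :=
  (exists_koszul h Y x).choose_spec hY X Z hX hZ

lemma isLeviCivita_leviCivita : IsLeviCivita h (leviCivita h) where
  torsion_free X Y x hX hY := by
    refine eq_of_inner_eq h fun Z hZ ↦ ?_
    rw [map_sub, sub_apply, inner_leviCivita h hX hY hZ, inner_leviCivita h hY hX hZ]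
    have h1 : (fun y ↦ h.inner y (Y y) (X y)) = fun y ↦ h.inner y (X y) (Y y) :=
      funext fun y ↦ h.symm y _ _
    simp only [koszul, h1, bracket]
    rw [mlieBracket_swap_apply (V := Y) (W := X), map_neg, neg_apply]
    ring
  metric X Y Z x hX hY hZ := by
    rw [inner_leviCivita h hX hY hZ, h.symm x (Y x), inner_leviCivita h hX hZ hY]
    have h1 : (fun y ↦ h.inner y (Z y) (Y y)) = fun y ↦ h.inner y (Y y) (Z y) :=
      funext fun y ↦ h.symm y _ _
    simp only [koszul, h1, bracket]
    rw [mlieBracket_swap_apply (V := Z) (W := Y), map_neg, neg_apply]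
    ring

end LeviCivita

/-! ### Calculus of smooth vector fields -/

section Calculus

variable [FiniteDimensional ℝ E]

lemma contMDiff_bracket (X Y : VectorFields E M) : CMDiff ∞ (T% (bracket X Y)) := fun x ↦ by
  have := FiniteDimensional.complete ℝ E
  have : IsManifold 𝓘(ℝ, E) (((⊤ : ℕ∞) : WithTop ℕ∞) + 1) M :=
    inferInstanceAs (IsManifold 𝓘(ℝ, E) ∞ M)
  have : IsManifold 𝓘(ℝ, E) (minSmoothness ℝ 2) M := by
    rw [minSmoothness_of_isRCLikeNormedField]; infer_instance
  exact ContMDiffAt.mlieBracket_vectorField (m := ⊤) (n := ⊤) X.contMDiff.contMDiffAt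
    Y.contMDiff.contMDiffAt (by simp)

instance : Bracket (VectorFields E M) (VectorFields E M) :=
  ⟨fun X Y ↦ ⟨bracket X Y, contMDiff_bracket X Y⟩⟩

lemma lie_apply' (X Y : VectorFields E M) (x : M) : ⁅X, Y⁆ x = bracket X Y x := rfl

/-- Smooth vector fields form a Lie ring. -/
instance : LieRing (VectorFields E M) where
  add_lie X Y Z := by
    ext x
    exact congrFun (bracket_add_left Z X Y (mdiff_field X) (mdiff_field Y)) x
  lie_add X Y Z := by
    ext x
    exact congrFun (bracket_add_right X Y Z (mdiff_field Y) (mdiff_field Z)) x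
  lie_self X := by
    ext x
    exact congrFun (mlieBracket_self (V := X)) x
  leibniz_lie X Y Z := by
    ext x
    have := FiniteDimensional.complete ℝ E
    have : IsManifold 𝓘(ℝ, E) (minSmoothness ℝ 3) M :=
      IsManifold.of_le (n := ∞) (by
        rw [minSmoothness_of_isRCLikeNormedField]
        exact WithTop.coe_le_coe.2 (le_top (a := (3 : ℕ∞))))
    have hle : minSmoothness ℝ 2 ≤ (∞ : WithTop ℕ∞) := by
      rw [minSmoothness_of_isRCLikeNormedField]
      exact WithTop.coe_le_coe.2 (le_top (a := (2 : ℕ∞)))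
    exact leibniz_identity_mlieBracket_apply (X.contMDiff.of_le hle x) (Y.contMDiff.of_le hle x)
      (Z.contMDiff.of_le hle x)

instance : LieAlgebra ℝ (VectorFields E M) where
  lie_smul c X Y := by
    ext x
    exact congrFun (bracket_smul_right X Y c (mdiff_field Y)) x

instance : SMul (Functions E M) (VectorFields E M) :=
  ⟨fun f X ↦ ⟨fun x ↦ f x • X x, f.contMDiff.smul_section X.contMDiff⟩⟩

@[simp]
lemma smul_field_apply (f : Functions E M) (X : VectorFields E M) (x : M) :
    (f • X) x = f x • X x := rfl

lemma contMDiff_derivAlong (X : VectorFields E M) (f : Functions E M) :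
    CMDiff ∞ (derivAlong X f) := by
  have h := (f.contMDiff.contMDiff_tangentMap (m := ∞) le_rfl).comp X.contMDiff
  intro x
  have h2 := (contMDiffAt_totalSpace.1 (h x)).2
  simp [tangentMap] at h2
  exact h2

/-- The derivative of a smooth function along a smooth vector field, as a smooth function. -/
def D (X : VectorFields E M) (f : Functions E M) : Functions E M :=
  ⟨derivAlong X f, contMDiff_derivAlong X f⟩

lemma D_apply (X : VectorFields E M) (f : Functions E M) (x : M) :
    D X f x = derivAlong X f x := rfl

@[simp]
lemma D_add (X : VectorFields E M) (f k : Functions E M) : D X (f + k) = D X f + D X k := by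
  ext x
  simp only [D_apply, derivAlong, ContMDiffMap.coe_add, Pi.add_apply]
  rw [mvfderiv_add (f.mdiffAt x) (k.mdiffAt x), add_apply]

@[simp]
lemma D_neg (X : VectorFields E M) (f : Functions E M) : D X (-f) = -D X f := by
  ext x
  simp only [D_apply, derivAlong, ContMDiffMap.coe_neg, Pi.neg_apply]
  rw [mvfderiv_neg, neg_apply]

@[simp]
lemma D_sub (X : VectorFields E M) (f k : Functions E M) : D X (f - k) = D X f - D X k := by
  rw [sub_eq_add_neg, D_add, D_neg, sub_eq_add_neg]

lemma D_eq_zero_of_const (X : VectorFields E M) {f : Functions E M} {c : ℝ} (hf : ∀ x, f x = c) :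
    D X f = 0 := by
  ext x
  have : (f : M → ℝ) = fun _ ↦ c := funext hf
  simp [D_apply, derivAlong, this, mvfderiv_const]

lemma lie_smul_field (X : VectorFields E M) (f : Functions E M) (Y : VectorFields E M) :
    ⁅X, f • Y⁆ = D X f • Y + f • ⁅X, Y⁆ := by
  have := FiniteDimensional.complete ℝ E
  ext x
  exact mlieBracket_smul_right (f.mdiffAt x) (mdiff_field Y x)

variable [T2Space M]

/-- The commutator of derivatives along vector fields. It follows from the Jacobi identity for
`X`, `Y` and a multiple `f • Z` of a field `Z` that does not vanish at the given point. -/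
lemma D_lie (X Y : VectorFields E M) (f : Functions E M) :
    D ⁅X, Y⁆ f = D X (D Y f) - D Y (D X f) := by
  ext x
  by_cases hX : ⁅X, Y⁆ x = 0 ∧ X x = 0 ∧ Y x = 0
  · simp [D_apply, derivAlong, hX]
  obtain ⟨Z, hZ⟩ : ∃ Z : VectorFields E M, Z x ≠ 0 := by
    by_contra! hc
    exact hX ⟨hc _, hc _, hc _⟩
  have h := congrArg (fun W : VectorFields E M ↦ W x) (leibniz_lie X Y (f • Z))
  simp only [lie_smul_field, lie_add, ContMDiffSection.coe_add, Pi.add_apply, smul_field_apply] at h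
  rw [leibniz_lie X Y Z] at h
  simp only [ContMDiffSection.coe_add, Pi.add_apply, smul_add] at h
  have h2 : (D ⁅X, Y⁆ f x - (D X (D Y f) x - D Y (D X f) x)) • Z x = 0 := by
    linear_combination (norm := module) (-1 : ℝ) • h
  exact sub_eq_zero.1 ((smul_eq_zero.1 h2).resolve_right hZ)

variable (h : PseudoRiemannianMetric E M)

lemma PseudoRiemannianMetric.pair_comm (X Y : VectorFields E M) : h.pair X Y = h.pair Y X :=
  ContMDiffMap.ext fun x ↦ h.symm x _ _

variable {h} in
/-- Vector fields with the same products with all vector fields agree. -/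
lemma PseudoRiemannianMetric.ext_pair {X Y : VectorFields E M}
    (hXY : ∀ Z x, h.pair X Z x = h.pair Y Z x) : X = Y := by
  ext x
  refine sub_eq_zero.1 (h.nondegenerate x _ fun w ↦ ?_)
  obtain ⟨Z, rfl⟩ := exists_vectorField (E := E) x w
  simpa [sub_eq_zero] using hXY Z x

/-- The value `dη(X, Y)` of the differential of the one-form `η = h(ξ, ·)`. -/
def dPair (ξ X Y : VectorFields E M) : Functions E M :=
  D X (h.pair ξ Y) - D Y (h.pair ξ X) - h.pair ξ ⁅X, Y⁆

variable {h} {cov : Connection E M}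

lemma IsKilling.D_pair_lie {K : VectorFields E M} (hK : IsKilling h.inner K)
    (Y Z : VectorFields E M) :
    D K (h.pair Y Z) = h.pair ⁅K, Y⁆ Z + h.pair Y ⁅K, Z⁆ :=
  ContMDiffMap.ext fun x ↦ hK Y Z x

lemma isKilling_iff {K : VectorFields E M} : IsKilling h.inner K ↔
    ∀ Y Z x, D K (h.pair Y Z) x = h.pair ⁅K, Y⁆ Z x + h.pair Y ⁅K, Z⁆ x := Iff.rfl

lemma IsKilling.lie {K L : VectorFields E M} (hK : IsKilling h.inner K)
    (hL : IsKilling h.inner L) : IsKilling h.inner ⁅K, L⁆ := isKilling_iff.2 fun Y Z x ↦ by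
  have h1 := leibniz_lie K L Y
  have h2 := leibniz_lie K L Z
  simp only [D_lie, hK.D_pair_lie, hL.D_pair_lie, D_add, h1, h2]
  simp only [ContMDiffMap.coe_add, ContMDiffMap.coe_sub, Pi.add_apply, Pi.sub_apply,
    PseudoRiemannianMetric.pair_apply, ContMDiffSection.coe_add, map_add, add_apply]
  ring

lemma IsKilling.smul {K : VectorFields E M} (hK : IsKilling h.inner K) (c : ℝ) :
    IsKilling h.inner (c • K) := isKilling_iff.2 fun Y Z x ↦ by
  have h1 := isKilling_iff.1 hK Y Z x
  simp only [smul_lie, PseudoRiemannianMetric.pair_apply, ContMDiffSection.coe_smul,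
    Pi.smul_apply, map_smul, smul_apply, D_apply, derivAlong, smul_eq_mul] at h1 ⊢
  linear_combination c * h1

lemma IsKilling.sub {K L : VectorFields E M} (hK : IsKilling h.inner K)
    (hL : IsKilling h.inner L) : IsKilling h.inner (K - L) := isKilling_iff.2 fun Y Z x ↦ by
  have h1 := isKilling_iff.1 hK Y Z x
  have h2 := isKilling_iff.1 hL Y Z x
  simp only [sub_lie, PseudoRiemannianMetric.pair_apply, ContMDiffSection.coe_sub,
    Pi.sub_apply, map_sub, sub_apply, D_apply, derivAlong] at h1 h2 ⊢
  linear_combination h1 - h2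

/-- The Lie derivative along a Killing field commutes with `ξ ↦ d(h(ξ, ·))`. -/
lemma IsKilling.D_dPair {K : VectorFields E M} (hK : IsKilling h.inner K)
    (ξ X Y : VectorFields E M) :
    D K (dPair h ξ X Y) = dPair h ⁅K, ξ⁆ X Y + dPair h ξ ⁅K, X⁆ Y + dPair h ξ X ⁅K, Y⁆ := by
  have h1 := D_lie K X (h.pair ξ Y)
  have h2 := D_lie K Y (h.pair ξ X)
  have h3 := congrArg (h.pair ξ) (leibniz_lie K X Y)
  ext x
  simp only [dPair, D_sub, hK.D_pair_lie, h1, h2, D_add, h3]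
  simp only [ContMDiffMap.coe_add, ContMDiffMap.coe_sub, Pi.add_apply, Pi.sub_apply,
    PseudoRiemannianMetric.pair_apply, ContMDiffSection.coe_add, map_add]
  ring

/-- The differential of `h(ξ, ·)` is closed. -/
lemma dPair_closed (ξ X Y Z : VectorFields E M) :
    D X (dPair h ξ Y Z) + D Y (dPair h ξ Z X) + D Z (dPair h ξ X Y)
      - dPair h ξ ⁅X, Y⁆ Z - dPair h ξ ⁅Y, Z⁆ X - dPair h ξ ⁅Z, X⁆ Y = 0 := by
  have h1 := D_lie X Y (h.pair ξ Z)
  have h2 := D_lie Y Z (h.pair ξ X)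
  have h3 := D_lie Z X (h.pair ξ Y)
  have e1 : ⁅⁅Y, Z⁆, X⁆ = -⁅X, ⁅Y, Z⁆⁆ := (lie_skew _ _).symm
  have e2 : ⁅⁅Z, X⁆, Y⁆ = -⁅Y, ⁅Z, X⁆⁆ := (lie_skew _ _).symm
  have e3 : ⁅⁅X, Y⁆, Z⁆ = ⁅X, ⁅Y, Z⁆⁆ + ⁅Y, ⁅Z, X⁆⁆ := by
    rw [leibniz_lie X Y Z, ← lie_skew X Z, lie_neg]; abel
  ext x
  simp only [dPair, D_sub, h1, h2, h3, e1, e2, e3]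
  simp only [ContMDiffMap.coe_add, ContMDiffMap.coe_sub, Pi.add_apply, Pi.sub_apply,
    PseudoRiemannianMetric.pair_apply, ContMDiffSection.coe_add, ContMDiffSection.coe_neg, map_add,
    Pi.neg_apply, map_neg, ContMDiffMap.coe_zero, Pi.zero_apply]
  ring

lemma IsLeviCivita.inner_eq (H : IsLeviCivita h cov) (X Y Z : VectorFields E M) (x : M) :
    2 * h.inner x (cov Y x (X x)) (Z x) =
      (D X (h.pair Y Z) + D Y (h.pair X Z) - D Z (h.pair X Y) + h.pair ⁅X, Y⁆ Z
        - h.pair ⁅X, Z⁆ Y - h.pair ⁅Y, Z⁆ X) x := by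
  have m (A B C : VectorFields E M) := H.metric A B C x (mdiff_field A x) (mdiff_field B x)
    (mdiff_field C x)
  have t (A B : VectorFields E M) := H.torsion_free A B x (mdiff_field A x) (mdiff_field B x)
  simp only [ContMDiffMap.coe_add, ContMDiffMap.coe_sub, Pi.add_apply, Pi.sub_apply,
    PseudoRiemannianMetric.pair_apply, lie_apply', ← t, map_sub, sub_apply]
  have e1 : D X (h.pair Y Z) x = _ := m X Y Z
  have e2 : D Y (h.pair X Z) x = _ := m Y X Z
  have e3 : D Z (h.pair X Y) x = _ := m Z X Y
  rw [e1, e2, e3, h.symm x (cov Z x (X x)), h.symm x (cov X x (Z x)), h.symm x (cov Z x (Y x)),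
    h.symm x (cov Y x (Z x))]
  ring

/-- The covariant derivative `∇_X Y` of smooth vector fields. -/
def nabla (H : IsLeviCivita h cov) (X Y : VectorFields E M) : VectorFields E M :=
  ofInner h (fun x ↦ cov Y x (X x)) fun Z ↦ by
    have := (D X (h.pair Y Z) + D Y (h.pair X Z) - D Z (h.pair X Y) + h.pair ⁅X, Y⁆ Z
        - h.pair ⁅X, Z⁆ Y - h.pair ⁅Y, Z⁆ X).contMDiff
    have e := fun x ↦ H.inner_eq X Y Z x
    refine (contMDiff_const (c := (1 / 2 : ℝ)).mul this).congr fun x ↦ ?_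
    rw [Pi.mul_apply, ← e]
    ring

@[simp]
lemma nabla_apply (H : IsLeviCivita h cov) (X Y : VectorFields E M) (x : M) :
    nabla H X Y x = cov Y x (X x) := rfl

lemma nabla_sub_nabla (H : IsLeviCivita h cov) (X Y : VectorFields E M) :
    nabla H X Y - nabla H Y X = ⁅X, Y⁆ := by
  ext x
  exact H.torsion_free X Y x (mdiff_field X x) (mdiff_field Y x)

lemma D_pair (H : IsLeviCivita h cov) (X Y Z : VectorFields E M) :
    D X (h.pair Y Z) = h.pair (nabla H X Y) Z + h.pair Y (nabla H X Z) :=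
  ContMDiffMap.ext fun x ↦ H.metric X Y Z x (mdiff_field X x) (mdiff_field Y x) (mdiff_field Z x)

lemma nabla_add (H : IsLeviCivita h cov) (X Y Z : VectorFields E M) :
    nabla H X (Y + Z) = nabla H X Y + nabla H X Z := by
  ext x
  simp [cov.isCovariantDerivativeOnUniv.add (mdiff_field Y x) (mdiff_field Z x)]

lemma nabla_smul (H : IsLeviCivita h cov) (X : VectorFields E M) (f : Functions E M)
    (Y : VectorFields E M) : nabla H X (f • Y) = D X f • Y + f • nabla H X Y := by
  ext x
  have : ⇑(f • Y) = (f : M → ℝ) • ⇑Y := rfl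
  simp only [nabla_apply, this, ContMDiffSection.coe_add, Pi.add_apply, smul_field_apply,
    cov.isCovariantDerivativeOnUniv.leibniz (mdiff_field Y x) (f.mdiffAt x)]
  simp [add_comm, D_apply]

lemma nabla_const_smul (H : IsLeviCivita h cov) (X : VectorFields E M) (c : ℝ)
    (Y : VectorFields E M) : nabla H X (c • Y) = c • nabla H X Y := by
  ext x
  simp [cov.isCovariantDerivativeOnUniv.smul_const c (mdiff_field Y x)]

lemma nabla_neg (H : IsLeviCivita h cov) (X Y : VectorFields E M) :
    nabla H X (-Y) = -nabla H X Y := by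
  simpa using nabla_const_smul H X (-1) Y

lemma nabla_sub (H : IsLeviCivita h cov) (X Y Z : VectorFields E M) :
    nabla H X (Y - Z) = nabla H X Y - nabla H X Z := by
  rw [sub_eq_add_neg, nabla_add, nabla_neg, sub_eq_add_neg]

/-- The covariant derivative of a Killing field is skew-symmetric. -/
lemma IsKilling.pair_nabla (H : IsLeviCivita h cov) {ξ : VectorFields E M}
    (hξ : IsKilling h.inner ξ)
    (X Y : VectorFields E M) (x : M) :
    h.inner x (cov ξ x (X x)) (Y x) = -h.inner x (X x) (cov ξ x (Y x)) := by
  have h1 := congrArg (fun f : Functions E M ↦ f x) (hξ.D_pair_lie X Y)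
  have h2 := congrArg (fun f : Functions E M ↦ f x) (D_pair H ξ X Y)
  simp only [← nabla_sub_nabla H, ContMDiffMap.coe_add, Pi.add_apply,
    PseudoRiemannianMetric.pair_apply, ContMDiffSection.coe_sub, Pi.sub_apply, map_sub, sub_apply,
    nabla_apply] at h1 h2
  linear_combination h1 - h2

lemma IsKilling.inner_nabla (H : IsLeviCivita h cov) {ξ : VectorFields E M}
    (hξ : IsKilling h.inner ξ) (x : M) (v w : TangentSpace 𝓘(ℝ, E) x) :
    h.inner x (cov ξ x v) w = -h.inner x v (cov ξ x w) := by
  obtain ⟨X, rfl⟩ := exists_vectorField (E := E) x v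
  obtain ⟨Y, rfl⟩ := exists_vectorField (E := E) x w
  exact hξ.pair_nabla H X Y x

/-- For a Killing field, `h(∇_X ξ, Y) = ½ dη(X, Y)`. -/
lemma IsKilling.dPair_eq (H : IsLeviCivita h cov) {ξ : VectorFields E M} (hξ : IsKilling h.inner ξ)
    (X Y : VectorFields E M) (x : M) :
    dPair h ξ X Y x = 2 * h.inner x (cov ξ x (X x)) (Y x) := by
  have h1 := hξ.pair_nabla H X Y x
  simp only [dPair, D_pair H, ← nabla_sub_nabla H, ContMDiffMap.coe_add, ContMDiffMap.coe_sub,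
    Pi.add_apply, PseudoRiemannianMetric.pair_apply, ContMDiffSection.coe_sub, Pi.sub_apply,
    map_sub, nabla_apply]
  rw [h.symm x (cov ξ x (Y x))]
  linear_combination -h1

/-- Killing fields preserve the Levi-Civita connection. -/
lemma IsKilling.lie_nabla (H : IsLeviCivita h cov) {K ξ : VectorFields E M}
    (hK : IsKilling h.inner K) (hξ : IsKilling h.inner ξ) (X : VectorFields E M) :
    ⁅K, nabla H X ξ⁆ = nabla H ⁅K, X⁆ ξ + nabla H X ⁅K, ξ⁆ := by
  refine PseudoRiemannianMetric.ext_pair (h := h) fun Y x ↦ ?_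
  have e (X Y : VectorFields E M) : dPair h ξ X Y = (2 : ℝ) • h.pair (nabla H X ξ) Y :=
    ContMDiffMap.ext fun x ↦ hξ.dPair_eq H X Y x
  have h1 := congrArg (fun f : Functions E M ↦ f x) (hK.D_dPair ξ X Y)
  have h2 := (hK.lie hξ).dPair_eq H X Y x
  have h3 : D K ((2 : ℝ) • h.pair (nabla H X ξ) Y) = (2 : ℝ) • D K (h.pair (nabla H X ξ) Y) := by
    rw [two_smul, two_smul, D_add]
  rw [e, e, e, h3, hK.D_pair_lie] at h1
  simp only [ContMDiffMap.coe_add, Pi.add_apply, ContMDiffMap.coe_smul, Pi.smul_apply,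
    PseudoRiemannianMetric.pair_apply, ContMDiffSection.coe_add, map_add, add_apply,
    nabla_apply, smul_eq_mul, h2] at h1 ⊢
  linear_combination (1 / 2 : ℝ) * h1

/-- If the product of two Killing fields is constant, their covariant derivatives along each
other are half of their Lie bracket. -/
lemma IsKilling.two_nabla_eq_lie (H : IsLeviCivita h cov) {ξ A : VectorFields E M}
    (hξ : IsKilling h.inner ξ) (hA : IsKilling h.inner A) {c : ℝ} (hc : ∀ x, h.pair ξ A x = c) :
    (2 : ℝ) • nabla H A ξ = ⁅A, ξ⁆ := by
  have key : nabla H ξ A = -nabla H A ξ := by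
    refine PseudoRiemannianMetric.ext_pair (h := h) fun X x ↦ ?_
    have h0 := congrArg (fun f : Functions E M ↦ f x) (D_eq_zero_of_const X hc)
    have h1 := hξ.pair_nabla H X A x
    have h2 := hA.pair_nabla H ξ X x
    simp only [D_pair H, ContMDiffMap.coe_add, Pi.add_apply, PseudoRiemannianMetric.pair_apply,
      nabla_apply, ContMDiffMap.coe_zero, Pi.zero_apply, ContMDiffSection.coe_neg, Pi.neg_apply,
      map_neg, neg_apply] at h0 ⊢
    rw [h2, h.symm x (cov ξ x (A x))]
    linear_combination -h0 + h1
  rw [← nabla_sub_nabla H, key, two_smul, sub_neg_eq_add]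

end Calculus

/-! ### The decomposition of the Killing fields of a K-contact manifold -/

section Decomposition

variable [FiniteDimensional ℝ E] [T2Space M]

lemma mem_iso_iff {g : RiemannianMetric E M} {A : VectorFields E M} :
    A ∈ iso g ↔ IsKilling (RiemannianMetric.toPseudo g).inner A := Iff.rfl

lemma mem_g₀_iff {g : RiemannianMetric E M} {ξ A : VectorFields E M} :
    A ∈ g₀ g ξ ↔ IsKilling (RiemannianMetric.toPseudo g).inner A ∧ ⁅ξ, A⁆ = 0 :=
  and_congr_right fun _ ↦ (ContMDiffSection.coe_injective.eq_iff (a := ⁅ξ, A⁆) (b := 0))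

lemma mem_g₂_iff {g : RiemannianMetric E M} {ξ A : VectorFields E M} :
    A ∈ g₂ g ξ ↔ IsKilling (RiemannianMetric.toPseudo g).inner A ∧ ⁅ξ, ⁅ξ, A⁆⁆ = (-4 : ℝ) • A :=
  and_congr_right fun _ ↦
    (ContMDiffSection.coe_injective.eq_iff (a := ⁅ξ, ⁅ξ, A⁆⁆) (b := (-4 : ℝ) • A))

variable {h : PseudoRiemannianMetric E M} {cov : Connection E M}

/-- A vector field of constant length is orthogonal to its covariant derivatives. -/
lemma pair_nabla_self (H : IsLeviCivita h cov) {ξ : VectorFields E M} {c : ℝ}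
    (hc : ∀ x, h.pair ξ ξ x = c) (x : M) (v : TangentSpace 𝓘(ℝ, E) x) :
    h.inner x (ξ x) (cov ξ x v) = 0 := by
  obtain ⟨X, rfl⟩ := exists_vectorField (E := E) x v
  have h0 := congrArg (fun f : Functions E M ↦ f x) (D_eq_zero_of_const X hc)
  simp only [D_pair H, ContMDiffMap.coe_add, Pi.add_apply, PseudoRiemannianMetric.pair_apply,
    nabla_apply, ContMDiffMap.coe_zero, Pi.zero_apply] at h0
  rw [h.symm x (cov ξ x (X x))] at h0
  linarith

/-- On Killing fields orthogonal to `ξ`, one has `L_ξ = -2∇ξ`, whose square is `-4` when `∇ξ` is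
a complex structure on the orthogonal of `ξ`. -/
lemma IsKilling.lie_lie_of_orthogonal (H : IsLeviCivita h cov) {ξ A : VectorFields E M}
    (hξ : IsKilling h.inner ξ) (hA : IsKilling h.inner A) (h1 : ∀ x, h.pair ξ ξ x = 1)
    (hsq : ∀ X, nabla H (nabla H X ξ) ξ = -X + h.pair ξ X • ξ) (hc : ∀ x, h.pair ξ A x = 0) :
    ⁅ξ, ⁅ξ, A⁆⁆ = (-4 : ℝ) • A := by
  have e1 := hξ.two_nabla_eq_lie H hA hc
  have hc' (x : M) : h.pair ξ ⁅A, ξ⁆ x = 0 := by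
    simp [← e1, pair_nabla_self H h1]
  have e2 := hξ.two_nabla_eq_lie H (hA.lie hξ) hc'
  have e3 : nabla H ⁅A, ξ⁆ ξ = (2 : ℝ) • nabla H (nabla H A ξ) ξ := by
    rw [← e1]; ext x; simp
  rw [← lie_skew ξ A, lie_neg, lie_skew, ← e2, e3, hsq]
  ext x
  have := hc x
  simp only [PseudoRiemannianMetric.pair_apply] at this
  simp only [ContMDiffSection.coe_smul, ContMDiffSection.coe_add, ContMDiffSection.coe_neg,
    Pi.smul_apply, Pi.add_apply, Pi.neg_apply, smul_field_apply, PseudoRiemannianMetric.pair_apply,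
    this]
  module

/-- A Killing field `A` satisfies `h(ξ, L_ξ A) = 0` if `ξ` has constant length. -/
lemma IsKilling.pair_lie_self {ξ A : VectorFields E M}
    (hA : IsKilling h.inner A) {c : ℝ} (hc : ∀ x, h.pair ξ ξ x = c) (x : M) :
    h.pair ξ ⁅ξ, A⁆ x = 0 := by
  have h0 := congrArg (fun f : Functions E M ↦ f x) (hA.D_pair_lie ξ ξ)
  simp only [D_eq_zero_of_const A hc, ContMDiffMap.coe_add, Pi.add_apply, h.pair_comm ⁅A, ξ⁆,
    ← lie_skew ξ A] at h0 ⊢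
  simp only [PseudoRiemannianMetric.pair_apply, ContMDiffSection.coe_neg, Pi.neg_apply, map_neg,
    ContMDiffMap.coe_zero, Pi.zero_apply] at h0 ⊢
  linarith

/-- For a Killing field `A`, the field `L_ξ A` is orthogonal to `ξ`, so `L_ξ³ A = -4 L_ξ A`. -/
lemma IsKilling.lie_lie_lie (H : IsLeviCivita h cov) {ξ A : VectorFields E M}
    (hξ : IsKilling h.inner ξ) (hA : IsKilling h.inner A) (h1 : ∀ x, h.pair ξ ξ x = 1)
    (hsq : ∀ X, nabla H (nabla H X ξ) ξ = -X + h.pair ξ X • ξ) :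
    ⁅ξ, ⁅ξ, ⁅ξ, A⁆⁆⁆ = (-4 : ℝ) • ⁅ξ, A⁆ :=
  hξ.lie_lie_of_orthogonal H (hξ.lie hA) h1 hsq (hA.pair_lie_self h1)

variable {g : RiemannianMetric E M} {ξ : VectorFields E M}
  {φ : Π x : M, TangentSpace 𝓘(ℝ, E) x →L[ℝ] TangentSpace 𝓘(ℝ, E) x}

lemma IsKContact.phi_eq {cov : Connection E M} (H : IsLeviCivita (RiemannianMetric.toPseudo g) cov)
    (hK : IsKContact g ξ φ) (x : M) (v : TangentSpace 𝓘(ℝ, E) x) : φ x v = cov ξ x v := by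
  obtain ⟨X, rfl⟩ := exists_vectorField (E := E) x v
  refine sub_eq_zero.1 ((RiemannianMetric.toPseudo g).nondegenerate x _ fun w ↦ ?_)
  obtain ⟨Y, rfl⟩ := exists_vectorField (E := E) x w
  have h1 := hK.phi X Y x
  have h2 : dDual g ξ X Y x = _ :=
    IsKilling.dPair_eq (h := RiemannianMetric.toPseudo g) H hK.killing X Y x
  rw [map_sub, sub_apply, sub_eq_zero]
  refine h1.trans ?_
  rw [h2]
  ring

lemma IsKContact.nabla_nabla {cov : Connection E M}
    (H : IsLeviCivita (RiemannianMetric.toPseudo g) cov) (hK : IsKContact g ξ φ)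
    (X : VectorFields E M) :
    nabla H (nabla H X ξ) ξ = -X + (RiemannianMetric.toPseudo g).pair ξ X • ξ := by
  ext x
  have := hK.phi_sq x (X x)
  rw [hK.phi_eq H, hK.phi_eq H] at this
  exact this

lemma IsKContact.disjoint : Disjoint (g₀ g ξ) (g₂ g ξ) := by
  rw [Submodule.disjoint_def]
  intro A h0 h2
  rw [mem_g₀_iff] at h0
  rw [mem_g₂_iff, h0.2, lie_zero] at h2
  exact (smul_eq_zero.1 h2.2.symm).resolve_left (by norm_num)

lemma IsKContact.sup_eq_iso (hK : IsKContact g ξ φ) : g₀ g ξ ⊔ g₂ g ξ = iso g := by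
  refine le_antisymm (sup_le (fun A hA ↦ hA.1) fun A hA ↦ hA.1) fun A hA ↦ ?_
  have hA' := mem_iso_iff.1 hA
  have hξ : IsKilling (RiemannianMetric.toPseudo g).inner ξ := hK.killing
  have e3 := hξ.lie_lie_lie (isLeviCivita_leviCivita _) hA' hK.unit (hK.nabla_nabla _)
  -- `A = (A + ¼ L_ξ² A) - ¼ L_ξ² A`, and `L_ξ (L_ξ² + 4) = 0`
  have hB : IsKilling (RiemannianMetric.toPseudo g).inner ((-4⁻¹ : ℝ) • ⁅ξ, ⁅ξ, A⁆⁆) :=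
    (hξ.lie (hξ.lie hA')).smul _
  rw [← sub_add_cancel A ((-4⁻¹ : ℝ) • ⁅ξ, ⁅ξ, A⁆⁆)]
  refine Submodule.add_mem_sup (mem_g₀_iff.2 ⟨hA'.sub hB, ?_⟩) (mem_g₂_iff.2 ⟨hB, ?_⟩)
  · rw [lie_sub, lie_smul, e3, smul_smul]
    norm_num
  · rw [lie_smul, lie_smul, e3, lie_smul, smul_comm]

end Decomposition

/-! ### Trilinear forms compatible with a quaternionic structure -/

section Quaternionic

lemma fin_three_add₁₁ (i : Fin 3) : i + 1 + 1 = i + 2 := by revert i; decide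

lemma fin_three_add₁₂ (i : Fin 3) : i + 1 + 2 = i := by revert i; decide

lemma fin_three_add₂₁ (i : Fin 3) : i + 2 + 1 = i := by revert i; decide

lemma fin_three_cases (i j : Fin 3) : j = i ∨ j = i + 1 ∨ j = i + 2 := by revert i j; decide

lemma fin_three_add₂₂ (i : Fin 3) : i + 2 + 2 = i + 1 := by revert i; decide

/-- The algebra behind Hitchin's lemma: three closed forms defining an almost hyperhermitian
structure define a hyperkähler structure. Here `a n` stands for `h((∇_X I n) Y, Z)`, `cyclic` for
closedness of the form of `I n`, `anti` and `comp` for the derivatives of `(I n)² = -1` and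
`I n ∘ I (n + 1) = I (n + 2)`, and the last three hypotheses for the quaternion relations.
Closedness makes each `I n` almost Kähler, `a n (I n X) Y Z = a n X Y (I n Z)`. Comparing this
property for the three structures gives `a n (I (n + 1) X) Y Z = -a n X Y (I (n + 1) Z)`, and then
`comp` forces `a n = 0`. -/
theorem quaternionic_eq_zero {W : Type*} (I : Fin 3 → W → W) (a : Fin 3 → W → W → W → ℝ)
    (skew : ∀ n X Y Z, a n X Y Z = -a n X Z Y)
    (cyclic : ∀ n X Y Z, a n X Y Z + a n Y Z X + a n Z X Y = 0)
    (anti : ∀ n X Y Z, a n X (I n Y) Z = a n X Y (I n Z))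
    (comp : ∀ n X Y Z, a (n + 2) X Y Z = a n X (I (n + 1) Y) Z - a (n + 1) X Y (I n Z))
    (sq : ∀ n i X Y Z, a n X (I i (I i Y)) Z = -a n X Y Z)
    (mul : ∀ n i X Y Z, a n X (I i (I (i + 1) Y)) Z = a n X (I (i + 2) Y) Z)
    (mul_swap : ∀ n i X Y Z, a n X (I (i + 1) (I i Y)) Z = -a n X (I (i + 2) Y) Z)
    (n : Fin 3) (X Y Z : W) : a n X Y Z = 0 := by
  have sq' (n i X Y Z) : a n X Y (I i (I i Z)) = -a n X Y Z := by
    rw [skew, sq, skew n X Y]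
  have mul' (n i X Y Z) : a n X Y (I i (I (i + 1) Z)) = a n X Y (I (i + 2) Z) := by
    rw [skew, mul, ← skew]
  have mul_swap' (n i X Y Z) : a n X Y (I (i + 1) (I i Z)) = -a n X Y (I (i + 2) Z) := by
    rw [skew, mul_swap, ← skew n X Y]
  have mul₁ (n i X Y Z) : a n (I i (I (i + 1) X)) Y Z = a n (I (i + 2) X) Y Z := by
    linear_combination cyclic n (I i (I (i + 1) X)) Y Z - cyclic n (I (i + 2) X) Y Z
      - mul n i Z X Y - mul' n i Y Z X
  -- the almost Kähler property, from the cyclic sums at `(I n X, Y, Z)`, `(X, I n Y, Z)`,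
  -- `(X, Y, I n Z)` and `(I n X, I n Y, I n Z)`
  have kahler (n X Y Z) : a n (I n X) Y Z = a n X Y (I n Z) := by
    have c1 := cyclic n (I n X) Y Z
    have c2 := cyclic n X (I n Y) Z
    have c3 := cyclic n X Y (I n Z)
    have c4 := cyclic n (I n X) (I n Y) (I n Z)
    simp only [anti, sq'] at c1 c2 c3 c4
    linarith
  -- the almost Kähler property of `a (n + 2)`, expressed through `a n` and `a (n + 1)`
  have key (n X Y Z) : a n (I (n + 1) X) (I (n + 1) Y) Z + a n X (I (n + 1) Y) (I (n + 1) Z) =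
      a (n + 1) (I (n + 2) X) Y Z + a (n + 1) X Y (I (n + 2) Z) := by
    have k := kahler (n + 2) X Y (I n Z)
    rw [comp, comp, ← mul₁, kahler, sq', sq'] at k
    have m1 := mul' n (n + 2) X (I (n + 1) Y) Z
    rw [fin_three_add₂₁, fin_three_add₂₂] at m1
    have m2 := mul_swap' (n + 1) (n + 2) X Y (I n Z)
    rw [fin_three_add₂₁, fin_three_add₂₂, mul_swap'] at m2
    linarith
  -- three applications of `key` lead back to `a n` with `Y` replaced by `I n (I n Y)`, that is
  -- with the opposite sign
  have zero (n X Y Z) : a n (I (n + 1) X) Y Z = -a n X Y (I (n + 1) Z) := by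
    have k1 := key n X (I (n + 2) (I n Y)) Z
    have k2 := key (n + 1) X (I n Y) Z
    have k3 := key (n + 2) X Y Z
    simp only [fin_three_add₁₁, fin_three_add₁₂, fin_three_add₂₁, fin_three_add₂₂] at k1 k2 k3
    have m (X Z) := mul n (n + 1) X (I n Y) Z
    simp only [fin_three_add₁₁, fin_three_add₁₂, sq] at m
    rw [m, m] at k1
    linarith
  have third (n X Y Z) : a (n + 1) (I n X) Y Z = a (n + 1) X Y (I n Z) := by
    have m := mul₁ (n + 1) (n + 1) X Y Z
    have m2 := mul_swap' (n + 1) (n + 1) X Y Z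
    rw [kahler, zero, fin_three_add₁₁, fin_three_add₁₂] at m
    rw [fin_three_add₁₁, fin_three_add₁₂] at m2
    linarith
  have key₂ (n X Y Z) : a (n + 1) X Y (I n Z) = a n X (I (n + 1) Y) Z := by
    have k := zero (n + 2) X Y (I n Z)
    simp only [fin_three_add₂₁, comp, kahler, third, sq'] at k
    linarith
  have := comp (n + 1) X Y Z
  rw [fin_three_add₁₂, fin_three_add₁₁] at this
  have k := key₂ (n + 1) X Y Z
  rw [fin_three_add₁₁] at k
  linarith

end Quaternionic

/-! ### The Sasakian equation for contact triples -/

section ContactTriple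

variable [FiniteDimensional ℝ E] [T2Space M]
  {h : PseudoRiemannianMetric E M} {cov : Connection E M}

/-- The vector field `φ X`, for `φ = -∇ξ`. -/
def phiField (H : IsLeviCivita h cov) (ξ X : VectorFields E M) : VectorFields E M :=
  -nabla H X ξ

@[simp]
lemma phiField_apply (H : IsLeviCivita h cov) (ξ X : VectorFields E M) (x : M) :
    phiField H ξ X x = phi cov ξ x (X x) := rfl

lemma cov_apply_eq (ξ : VectorFields E M) (x : M) (v : TangentSpace 𝓘(ℝ, E) x) :
    cov ξ x v = -phi cov ξ x v := (neg_neg _).symm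

lemma IsKilling.inner_phi (H : IsLeviCivita h cov) {ξ : VectorFields E M}
    (hξ : IsKilling h.inner ξ) (x : M) (v w : TangentSpace 𝓘(ℝ, E) x) :
    h.inner x (phi cov ξ x v) w = -h.inner x v (phi cov ξ x w) := by
  have := hξ.inner_nabla H x v w
  simp only [cov_apply_eq, map_neg, neg_apply] at this
  linarith

lemma inner_self_phi (H : IsLeviCivita h cov) {ξ : VectorFields E M} {c : ℝ}
    (hc : ∀ x, h.inner x (ξ x) (ξ x) = c) (x : M) (v : TangentSpace 𝓘(ℝ, E) x) :
    h.inner x (ξ x) (phi cov ξ x v) = 0 := by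
  have := pair_nabla_self H hc x v
  simpa only [cov_apply_eq, map_neg, neg_eq_zero] using this

lemma IsKilling.phi_self (H : IsLeviCivita h cov) {ξ : VectorFields E M}
    (hξ : IsKilling h.inner ξ) {c : ℝ} (hc : ∀ x, h.inner x (ξ x) (ξ x) = c) (x : M) :
    phi cov ξ x (ξ x) = 0 :=
  h.nondegenerate x _ fun v ↦ by rw [hξ.inner_phi H, inner_self_phi H hc, neg_zero]

/-- Three orthogonal time-like unit Killing fields whose endomorphisms `φ = -∇ξ` satisfy the
quaternionic relations of a pseudo 3-Sasakian structure; the Sasakian equations are not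
required. -/
structure IsContactTriple (h : PseudoRiemannianMetric E M) (cov : Connection E M)
    (ξ : Fin 3 → VectorFields E M) : Prop where
  leviCivita : IsLeviCivita h cov
  killing : ∀ i, IsKilling h.inner (ξ i)
  timelike : ∀ i x, h.inner x (ξ i x) (ξ i x) = -1
  orthogonal : ∀ i j, i ≠ j → ∀ x, h.inner x (ξ i x) (ξ j x) = 0
  phi_comp : ∀ (i : Fin 3) (x : M) (v : TangentSpace 𝓘(ℝ, E) x),
    phi cov (ξ i) x (phi cov (ξ (i + 1)) x v) =
      phi cov (ξ (i + 2)) x v - h.inner x (ξ (i + 1) x) v • ξ i x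
  phi_comp_swap : ∀ (i : Fin 3) (x : M) (v : TangentSpace 𝓘(ℝ, E) x),
    phi cov (ξ (i + 1)) x (phi cov (ξ i) x v) =
      -phi cov (ξ (i + 2)) x v - h.inner x (ξ i x) v • ξ (i + 1) x

lemma IsPseudoThreeSasakian.isContactTriple {ξ : Fin 3 → VectorFields E M}
    (hξ : IsPseudoThreeSasakian h cov ξ) : IsContactTriple h cov ξ where
  leviCivita := hξ.leviCivita
  killing i := (hξ.sasakian i).killing
  timelike i := (hξ.sasakian i).timelike
  orthogonal := hξ.orthogonal
  phi_comp := hξ.phi_comp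
  phi_comp_swap := hξ.phi_comp_swap

namespace IsContactTriple

variable {ξ : Fin 3 → VectorFields E M}

lemma phi_self (T : IsContactTriple h cov ξ) (i : Fin 3) (x : M) : phi cov (ξ i) x (ξ i x) = 0 :=
  (T.killing i).phi_self T.leviCivita (T.timelike i) x

lemma phi_succ (T : IsContactTriple h cov ξ) (i : Fin 3) (x : M) :
    phi cov (ξ i) x (ξ (i + 1) x) = ξ (i + 2) x := by
  have h1 := T.phi_comp_swap (i + 1) x (ξ (i + 1) x)
  rw [T.phi_self, map_zero, T.timelike, fin_three_add₁₂, fin_three_add₁₁] at h1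
  linear_combination (norm := module) h1

lemma phi_succ_succ (T : IsContactTriple h cov ξ) (i : Fin 3) (x : M) :
    phi cov (ξ i) x (ξ (i + 2) x) = -ξ (i + 1) x := by
  have h1 := T.phi_comp (i + 1) x (ξ (i + 2) x)
  rw [fin_three_add₁₁, T.phi_self, map_zero, T.timelike, fin_three_add₁₂] at h1
  linear_combination (norm := module) -h1

lemma inner_eq_ite (T : IsContactTriple h cov ξ) (i j : Fin 3) (x : M) :
    h.inner x (ξ i x) (ξ j x) = if i = j then -1 else 0 := by
  split_ifs with hij
  · rw [hij, T.timelike]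
  · exact T.orthogonal i j hij x

lemma inner_phi (T : IsContactTriple h cov ξ) (i : Fin 3) (x : M)
    (v w : TangentSpace 𝓘(ℝ, E) x) :
    h.inner x (phi cov (ξ i) x v) w = -h.inner x v (phi cov (ξ i) x w) :=
  (T.killing i).inner_phi T.leviCivita x v w

/-- The failure of the Sasakian equation for `ξ i`, as a vector field. -/
def defect (T : IsContactTriple h cov ξ) (i : Fin 3) (X Y : VectorFields E M) :
    VectorFields E M :=
  nabla T.leviCivita X (phiField T.leviCivita (ξ i) Y)
    - phiField T.leviCivita (ξ i) (nabla T.leviCivita X Y) + h.pair X Y • ξ i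
    - h.pair (ξ i) Y • X

lemma defect_apply (T : IsContactTriple h cov ξ) (i : Fin 3) (X Y : VectorFields E M) (x : M) :
    T.defect i X Y x = cov (phiField T.leviCivita (ξ i) Y) x (X x)
      - phi cov (ξ i) x (cov Y x (X x)) + h.inner x (X x) (Y x) • ξ i x
      - h.inner x (ξ i x) (Y x) • X x := rfl

lemma defect_add (T : IsContactTriple h cov ξ) (i : Fin 3) (X Y Z : VectorFields E M) :
    T.defect i X (Y + Z) = T.defect i X Y + T.defect i X Z := by
  have e : phiField T.leviCivita (ξ i) (Y + Z) =
      phiField T.leviCivita (ξ i) Y + phiField T.leviCivita (ξ i) Z := by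
    ext x; simp
  ext x
  rw [defect, e, nabla_add, nabla_add]
  simp [defect_apply]
  module

lemma defect_smul (T : IsContactTriple h cov ξ) (i : Fin 3) (X Y : VectorFields E M)
    (f : Functions E M) : T.defect i X (f • Y) = f • T.defect i X Y := by
  have e : phiField T.leviCivita (ξ i) (f • Y) = f • phiField T.leviCivita (ξ i) Y := by
    ext x; simp
  ext x
  rw [defect, e, nabla_smul, nabla_smul]
  simp [defect_apply]
  module

lemma defect_neg (T : IsContactTriple h cov ξ) (i : Fin 3) (X Y : VectorFields E M) :
    T.defect i X (-Y) = -T.defect i X Y := by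
  have := T.defect_smul i X Y (-1)
  have e (Z : VectorFields E M) : (-1 : Functions E M) • Z = -Z := by
    ext x; simp
  rwa [e, e] at this

/-- The defect is skew-symmetric, since `φ i` is. -/
lemma inner_defect_skew (T : IsContactTriple h cov ξ) (i : Fin 3) (X Y Z : VectorFields E M)
    (x : M) : h.inner x (T.defect i X Y x) (Z x) = -h.inner x (T.defect i X Z x) (Y x) := by
  have h0 : h.pair (phiField T.leviCivita (ξ i) Y) Z = -h.pair (phiField T.leviCivita (ξ i) Z) Y :=
    ContMDiffMap.ext fun y ↦ by
      simp [T.inner_phi i y (Y y), h.symm y (Y y)]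
  have h1 := congrArg (fun f : Functions E M ↦ D X f x) h0
  simp only [D_neg, D_pair T.leviCivita, ContMDiffMap.coe_add, Pi.add_apply,
    PseudoRiemannianMetric.pair_apply, nabla_apply, ContMDiffMap.coe_neg, Pi.neg_apply,
    phiField_apply] at h1
  simp only [defect_apply, map_add, map_sub, map_smul, add_apply, sub_apply, smul_apply,
    smul_eq_mul]
  have i1 := T.inner_phi i x (cov Y x (X x)) (Z x)
  have i2 := T.inner_phi i x (cov Z x (X x)) (Y x)
  have s1 := h.symm x (phi cov (ξ i) x (Y x)) (cov Z x (X x))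
  have s2 := h.symm x (phi cov (ξ i) x (Z x)) (cov Y x (X x))
  linear_combination h1 - i1 - i2 - s1 - s2

/-- The cyclic sum of the defect vanishes, since the form `h(φ i ·, ·)` is exact. -/
lemma inner_defect_cyclic (T : IsContactTriple h cov ξ) (i : Fin 3) (X Y Z : VectorFields E M)
    (x : M) : h.inner x (T.defect i X Y x) (Z x) + h.inner x (T.defect i Y Z x) (X x)
      + h.inner x (T.defect i Z X x) (Y x) = 0 := by
  have e (X Y : VectorFields E M) :
      dPair h (ξ i) X Y = (-2 : ℝ) • h.pair (phiField T.leviCivita (ξ i) X) Y := by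
    refine ContMDiffMap.ext fun x ↦ ((T.killing i).dPair_eq T.leviCivita X Y x).trans ?_
    simp [cov_apply_eq]
  have e2 (X : VectorFields E M) (f : Functions E M) : D X ((-2 : ℝ) • f) = (-2 : ℝ) • D X f := by
    rw [neg_smul, neg_smul, two_smul, two_smul, D_neg, D_add]
  have h1 := congrArg (fun f : Functions E M ↦ f x) (dPair_closed (h := h) (ξ i) X Y Z)
  simp only [e, e2, D_pair T.leviCivita, ← nabla_sub_nabla T.leviCivita, ContMDiffMap.coe_add,
    ContMDiffMap.coe_sub, Pi.add_apply, Pi.sub_apply, ContMDiffMap.coe_smul, Pi.smul_apply,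
    PseudoRiemannianMetric.pair_apply, nabla_apply, phiField_apply, smul_eq_mul,
    ContMDiffMap.coe_zero, Pi.zero_apply, ContMDiffSection.coe_sub, map_sub, sub_apply] at h1
  simp only [defect_apply, map_add, map_sub, map_smul, add_apply, sub_apply, smul_apply,
    smul_eq_mul]
  have skew (A B C : VectorFields E M) :
      h.inner x (phi cov (ξ i) x (A x)) (cov B x (C x)) =
        -h.inner x (phi cov (ξ i) x (cov B x (C x))) (A x) := by
    rw [T.inner_phi, h.symm]
  rw [skew, skew, skew] at h1
  have t1 := h.symm x (X x) (Y x)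
  have t2 := h.symm x (X x) (Z x)
  have t3 := h.symm x (Y x) (Z x)
  rw [← t1, t2, t3]
  linear_combination (-1 / 2 : ℝ) * h1

/-- The derivative of `φ i ∘ φ i = -1 - h(ξ i, ·) ξ i`. -/
lemma defect_phiField (T : IsContactTriple h cov ξ) (i : Fin 3) (X Y : VectorFields E M)
    (hsq : ∀ x v, phi cov (ξ i) x (phi cov (ξ i) x v) = -v - h.inner x (ξ i x) v • ξ i x) (x : M) :
    T.defect i X (phiField T.leviCivita (ξ i) Y) x = -phi cov (ξ i) x (T.defect i X Y x) := by
  have e : phiField T.leviCivita (ξ i) (phiField T.leviCivita (ξ i) Y) =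
      -Y - h.pair (ξ i) Y • ξ i := by
    ext x
    exact hsq x _
  have e2 := congrArg (fun f : Functions E M ↦ f x) (D_pair T.leviCivita X (ξ i) Y)
  simp only [ContMDiffMap.coe_add, Pi.add_apply, PseudoRiemannianMetric.pair_apply,
    nabla_apply, cov_apply_eq (ξ i)] at e2
  have e3 := T.inner_phi i x (X x) (Y x)
  have e4 := (T.killing i).inner_phi T.leviCivita x (ξ i x) (Y x)
  rw [T.phi_self, map_zero, zero_apply, zero_eq_neg] at e4
  rw [defect, e, nabla_sub, nabla_neg, nabla_smul, defect_apply]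
  simp only [ContMDiffSection.coe_add, ContMDiffSection.coe_sub, ContMDiffSection.coe_neg,
    Pi.add_apply, Pi.sub_apply, Pi.neg_apply, smul_field_apply, PseudoRiemannianMetric.pair_apply,
    nabla_apply, phiField_apply, map_add, map_sub, map_smul, T.phi_self, hsq, e2, e4,
    cov_apply_eq (ξ i)]
  rw [map_neg, neg_apply, e3]
  module

/-- The derivative of `φ i ∘ φ (i + 1) = φ (i + 2) - h(ξ (i + 1), ·) ξ i`. -/
lemma defect_comp (T : IsContactTriple h cov ξ) (i : Fin 3) (X Y : VectorFields E M) (x : M) :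
    T.defect (i + 2) X Y x = T.defect i X (phiField T.leviCivita (ξ (i + 1)) Y) x
      + phi cov (ξ i) x (T.defect (i + 1) X Y x) := by
  have e : phiField T.leviCivita (ξ i) (phiField T.leviCivita (ξ (i + 1)) Y) =
      phiField T.leviCivita (ξ (i + 2)) Y - h.pair (ξ (i + 1)) Y • ξ i := by
    ext x
    exact T.phi_comp i x _
  have e2 := congrArg (fun f : Functions E M ↦ f x) (D_pair T.leviCivita X (ξ (i + 1)) Y)
  simp only [ContMDiffMap.coe_add, Pi.add_apply, PseudoRiemannianMetric.pair_apply,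
    nabla_apply, cov_apply_eq (ξ (i + 1))] at e2
  have e3 := T.inner_phi (i + 1) x (X x) (Y x)
  have e4 := T.inner_phi (i + 1) x (ξ i x) (Y x)
  have e5 := T.phi_succ_succ (i + 1) x
  rw [fin_three_add₁₂, fin_three_add₁₁] at e5
  rw [e5, map_neg, neg_apply, neg_inj] at e4
  rw [defect.eq_1 T i, e, nabla_sub, nabla_smul, defect_apply, defect_apply]
  simp only [ContMDiffSection.coe_add, ContMDiffSection.coe_sub,
    Pi.add_apply, Pi.sub_apply, smul_field_apply, PseudoRiemannianMetric.pair_apply,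
    nabla_apply, phiField_apply, map_add, map_sub, map_smul, T.phi_succ, T.phi_comp, e2, ← e4,
    cov_apply_eq (ξ i)]
  rw [map_neg, neg_apply, e3]
  module

lemma defect_self (T : IsContactTriple h cov ξ) (i j : Fin 3) (X : VectorFields E M)
    (hsq : ∀ x v, phi cov (ξ i) x (phi cov (ξ i) x v) = -v - h.inner x (ξ i x) v • ξ i x) (x : M) :
    T.defect i X (ξ j) x = 0 := by
  rcases fin_three_cases i j with rfl | rfl | rfl
  · have e : phiField T.leviCivita (ξ j) (ξ j) = 0 := by
      ext x
      exact T.phi_self j x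
    rw [defect, e]
    simp [nabla_apply, cov_apply_eq (ξ j), hsq]
    rw [h.symm x (X x), T.timelike]
    module
  · have e : phiField T.leviCivita (ξ i) (ξ (i + 1)) = ξ (i + 2) := by
      ext x
      exact T.phi_succ i x
    rw [defect, e]
    simp [nabla_apply, cov_apply_eq, T.phi_comp]
    rw [h.symm x (X x), T.orthogonal i (i + 1) (by simp)]
    module
  · have e : phiField T.leviCivita (ξ i) (ξ (i + 2)) = -ξ (i + 1) := by
      ext x
      exact T.phi_succ_succ i x
    have e2 := T.phi_comp_swap (i + 2) x (X x)
    rw [fin_three_add₂₁, fin_three_add₂₂] at e2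
    rw [defect, e, nabla_neg]
    simp [nabla_apply, cov_apply_eq, e2]
    rw [h.symm x (X x), T.orthogonal i (i + 2) (by simp)]
    module

/-- The three vector fields of a contact triple satisfy the Sasakian equation. The defects of the
three equations are tensors satisfying the hypotheses of `quaternionic_eq_zero`, hence vanish.
This is the theorem of Kashiwada that metric 3-contact structures are 3-Sasakian; the signature of
the metric plays no role in it. -/
theorem isPseudoThreeSasakian (T : IsContactTriple h cov ξ)
    (hsq : ∀ i x v, phi cov (ξ i) x (phi cov (ξ i) x v) = -v - h.inner x (ξ i x) v • ξ i x) :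
    IsPseudoThreeSasakian h cov ξ := by
  have key (i : Fin 3) (X Y : VectorFields E M) (x : M) : T.defect i X Y x = 0 := by
    refine h.nondegenerate x _ fun w ↦ ?_
    obtain ⟨Z, rfl⟩ := exists_vectorField (E := E) x w
    -- the defects are `C^∞`-linear in `Y` and vanish if `Y` is one of the `ξ j`
    have vert (n j : Fin 3) (X Y Z : VectorFields E M) (f : Functions E M) :
        h.inner x (T.defect n X (Y - f • ξ j) x) (Z x) = h.inner x (T.defect n X Y x) (Z x) := by
      rw [sub_eq_add_neg, defect_add, defect_neg, defect_smul]
      simp [T.defect_self n j X (hsq n) x]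
    refine quaternionic_eq_zero (fun i ↦ phiField T.leviCivita (ξ i))
      (fun n X Y Z ↦ h.inner x (T.defect n X Y x) (Z x)) ?_ ?_ ?_ ?_ ?_ ?_ ?_ i X Y Z
    · exact fun n X Y Z ↦ T.inner_defect_skew n X Y Z x
    · exact fun n X Y Z ↦ T.inner_defect_cyclic n X Y Z x
    · intro n X Y Z
      rw [T.defect_phiField n X Y (hsq n), map_neg, neg_apply, T.inner_phi, neg_neg, phiField_apply]
    · intro n X Y Z
      rw [T.defect_comp, map_add, add_apply, T.inner_phi, phiField_apply, sub_eq_add_neg]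
    · intro n i X Y Z
      have e : phiField T.leviCivita (ξ i) (phiField T.leviCivita (ξ i) Y) =
          -Y - h.pair (ξ i) Y • ξ i := by
        ext x
        exact hsq i x _
      rw [e, vert, defect_neg]
      simp
    · intro n i X Y Z
      have e : phiField T.leviCivita (ξ i) (phiField T.leviCivita (ξ (i + 1)) Y) =
          phiField T.leviCivita (ξ (i + 2)) Y - h.pair (ξ (i + 1)) Y • ξ i := by
        ext x
        exact T.phi_comp i x _
      rw [e, vert]
    · intro n i X Y Z
      have e : phiField T.leviCivita (ξ (i + 1)) (phiField T.leviCivita (ξ i) Y) =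
          -phiField T.leviCivita (ξ (i + 2)) Y - h.pair (ξ i) Y • ξ (i + 1) := by
        ext x
        exact T.phi_comp_swap i x _
      rw [e, vert, defect_neg]
      simp
  refine ⟨T.leviCivita, fun i ↦ ⟨T.killing i, T.timelike i, fun X Y x ↦ ?_⟩, T.orthogonal,
    T.phi_comp, T.phi_comp_swap⟩
  have k := key i X Y x
  have e : phiField T.leviCivita (ξ i) Y = -nabla T.leviCivita Y (ξ i) := rfl
  rw [defect, e, nabla_neg] at k
  have e2 : (fun y ↦ cov (ξ i) y (Y y)) = ⇑(nabla T.leviCivita Y (ξ i)) := rfl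
  simp only [ContMDiffSection.coe_add, ContMDiffSection.coe_sub, ContMDiffSection.coe_neg,
    Pi.add_apply, Pi.sub_apply, Pi.neg_apply, smul_field_apply, PseudoRiemannianMetric.pair_apply,
    nabla_apply, phiField_apply, phi, neg_apply] at k
  rw [e2]
  linear_combination (norm := module) -k

end IsContactTriple

end ContactTriple

/-! ### Killing triples -/

section KillingTriple

variable [FiniteDimensional ℝ E] [T2Space M]
  {k : PseudoRiemannianMetric E M} {cov : Connection E M}

/-- Three orthonormal Killing fields spanning a Lie algebra `𝔰𝔲(2)`, the first of which satisfies
`(∇ξ)² = -1 + η ⊗ ξ`. -/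
structure IsKillingTriple (k : PseudoRiemannianMetric E M) (cov : Connection E M)
    (ξ : Fin 3 → VectorFields E M) : Prop where
  leviCivita : IsLeviCivita k cov
  killing : ∀ i, IsKilling k.inner (ξ i)
  unit : ∀ i x, k.inner x (ξ i x) (ξ i x) = 1
  orthogonal : ∀ i j, i ≠ j → ∀ x, k.inner x (ξ i x) (ξ j x) = 0
  lie_succ : ∀ i, ⁅ξ i, ξ (i + 1)⁆ = (2 : ℝ) • ξ (i + 2)
  sq_zero : ∀ x v, cov (ξ 0) x (cov (ξ 0) x v) = -v + k.inner x (ξ 0 x) v • ξ 0 x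

namespace IsKillingTriple

variable {ξ : Fin 3 → VectorFields E M}

lemma lie_succ_succ (T : IsKillingTriple k cov ξ) (i : Fin 3) :
    ⁅ξ i, ξ (i + 2)⁆ = (-2 : ℝ) • ξ (i + 1) := by
  have := T.lie_succ (i + 2)
  rw [fin_three_add₂₁, fin_three_add₂₂] at this
  rw [← lie_skew, this, neg_smul]

lemma lie_succ_self (T : IsKillingTriple k cov ξ) (i : Fin 3) :
    ⁅ξ (i + 1), ξ i⁆ = (-2 : ℝ) • ξ (i + 2) := by
  rw [← lie_skew, T.lie_succ, neg_smul]

lemma lie_succ_succ' (T : IsKillingTriple k cov ξ) (i : Fin 3) :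
    ⁅ξ (i + 1), ξ (i + 2)⁆ = (2 : ℝ) • ξ i := by
  have := T.lie_succ (i + 1)
  rwa [fin_three_add₁₂, fin_three_add₁₁] at this

lemma inner_cov (T : IsKillingTriple k cov ξ) (i : Fin 3) (x : M)
    (v w : TangentSpace 𝓘(ℝ, E) x) :
    k.inner x (cov (ξ i) x v) w = -k.inner x v (cov (ξ i) x w) :=
  (T.killing i).inner_nabla T.leviCivita x v w

lemma cov_of_lie (T : IsKillingTriple k cov ξ) {i j : Fin 3} {c : ℝ}
    (hc : ∀ x, k.pair (ξ i) (ξ j) x = c) {X : VectorFields E M} (hX : ⁅ξ j, ξ i⁆ = (2 : ℝ) • X)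
    (x : M) : cov (ξ i) x (ξ j x) = X x := by
  have h1 := (T.killing i).two_nabla_eq_lie T.leviCivita (T.killing j) hc
  rw [hX] at h1
  exact congrArg (fun X : VectorFields E M ↦ X x) (smul_right_injective _ two_ne_zero h1)

lemma cov_self (T : IsKillingTriple k cov ξ) (i : Fin 3) (x : M) :
    cov (ξ i) x (ξ i x) = 0 :=
  T.cov_of_lie (X := 0) (T.unit i) (by simp) x

lemma cov_succ (T : IsKillingTriple k cov ξ) (i : Fin 3) (x : M) :
    cov (ξ i) x (ξ (i + 1) x) = -ξ (i + 2) x :=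
  T.cov_of_lie (X := -ξ (i + 2)) (T.orthogonal i (i + 1) (by simp))
    (by rw [T.lie_succ_self]; simp) x

lemma cov_succ_succ (T : IsKillingTriple k cov ξ) (i : Fin 3) (x : M) :
    cov (ξ i) x (ξ (i + 2) x) = ξ (i + 1) x :=
  T.cov_of_lie (T.orthogonal i (i + 2) (by simp))
    (by rw [← lie_skew, T.lie_succ_succ, neg_smul, neg_neg]) x

lemma cov₁ (T : IsKillingTriple k cov ξ) (i : Fin 3) (x : M) :
    cov (ξ (i + 1)) x (ξ i x) = ξ (i + 2) x ∧
    cov (ξ (i + 1)) x (ξ (i + 2) x) = -ξ i x := by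
  have h1 := T.cov_succ (i + 1) x
  have h2 := T.cov_succ_succ (i + 1) x
  rw [fin_three_add₁₁, fin_three_add₁₂] at h1 h2
  exact ⟨h2, h1⟩

lemma cov₂ (T : IsKillingTriple k cov ξ) (i : Fin 3) (x : M) :
    cov (ξ (i + 2)) x (ξ i x) = -ξ (i + 1) x ∧
    cov (ξ (i + 2)) x (ξ (i + 1) x) = ξ i x := by
  have h1 := T.cov_succ (i + 2) x
  have h2 := T.cov_succ_succ (i + 2) x
  rw [fin_three_add₂₁, fin_three_add₂₂] at h1 h2
  exact ⟨h1, h2⟩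

lemma lie_nabla_self (T : IsKillingTriple k cov ξ) (i : Fin 3) (X : VectorFields E M) :
    ⁅ξ i, nabla T.leviCivita X (ξ i)⁆ = nabla T.leviCivita ⁅ξ i, X⁆ (ξ i) := by
  rw [(T.killing i).lie_nabla T.leviCivita (T.killing i), lie_self]
  ext x; simp

lemma lie_nabla_succ (T : IsKillingTriple k cov ξ) (i : Fin 3) (X : VectorFields E M) :
    ⁅ξ (i + 1), nabla T.leviCivita X (ξ (i + 2))⁆ =
      nabla T.leviCivita ⁅ξ (i + 1), X⁆ (ξ (i + 2)) + (2 : ℝ) • nabla T.leviCivita X (ξ i) := by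
  rw [(T.killing _).lie_nabla T.leviCivita (T.killing _), T.lie_succ_succ', nabla_const_smul]

lemma lie_nabla_succ_self (T : IsKillingTriple k cov ξ) (i : Fin 3) (X : VectorFields E M) :
    ⁅ξ (i + 1), nabla T.leviCivita X (ξ i)⁆ =
      nabla T.leviCivita ⁅ξ (i + 1), X⁆ (ξ i) + (-2 : ℝ) • nabla T.leviCivita X (ξ (i + 2)) := by
  rw [(T.killing _).lie_nabla T.leviCivita (T.killing _), T.lie_succ_self, nabla_const_smul]

/-- Lie derivative of the endomorphism field `η i ⊗ ξ j` along a Killing field. -/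
lemma lie_pair_smul {K : VectorFields E M} (hK : IsKilling k.inner K) (ξ ζ X : VectorFields E M) :
    ⁅K, k.pair ξ X • ζ⁆ = k.pair ξ ⁅K, X⁆ • ζ + k.pair ⁅K, ξ⁆ X • ζ + k.pair ξ X • ⁅K, ζ⁆ := by
  rw [lie_smul_field, hK.D_pair_lie]
  ext x
  simp
  module

/-- The Lie derivative along `ξ (i + 1)` rotates `∇ξ i` into `∇ξ (i + 2)`. Applied once to
`(∇ξ i)² = -1 + η i ⊗ ξ i` it gives the anticommutation relation, applied twice it gives the square
of `∇ξ (i + 2)`. -/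
lemma sq_and_anticomm_of_sq (T : IsKillingTriple k cov ξ) (i : Fin 3)
    (hsq : ∀ x v, cov (ξ i) x (cov (ξ i) x v) = -v + k.inner x (ξ i x) v • ξ i x) :
    (∀ x v, cov (ξ (i + 2)) x (cov (ξ (i + 2)) x v) =
      -v + k.inner x (ξ (i + 2) x) v • ξ (i + 2) x) ∧
    (∀ x v, cov (ξ i) x (cov (ξ (i + 2)) x v) + cov (ξ (i + 2)) x (cov (ξ i) x v) =
      k.inner x (ξ (i + 2) x) v • ξ i x + k.inner x (ξ i x) v • ξ (i + 2) x) := by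
  let F (j : Fin 3) (X : VectorFields E M) := nabla T.leviCivita X (ξ j)
  have hsq' (X : VectorFields E M) : F i (F i X) = -X + k.pair (ξ i) X • ξ i := by
    ext x
    exact hsq x _
  have hadd (j) (X Y : VectorFields E M) : F j (X + Y) = F j X + F j Y := by
    ext x; simp [F]
  have hsmul (j) (c : ℝ) (X : VectorFields E M) : F j (c • X) = c • F j X := by
    ext x; simp [F]
  have l0 (X) : ⁅ξ (i + 1), F i X⁆ = _ := T.lie_nabla_succ_self i X
  have l2 (X) : ⁅ξ (i + 1), F (i + 2) X⁆ = _ := T.lie_nabla_succ i X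
  have pl := fun a b X ↦ lie_pair_smul (T.killing (i + 1)) (ξ a) (ξ b) X
  change ∀ X, _ = F i _ + (-2 : ℝ) • F (i + 2) X at l0
  change ∀ X, _ = F (i + 2) _ + (2 : ℝ) • F i X at l2
  have anti (X : VectorFields E M) : F i (F (i + 2) X) + F (i + 2) (F i X) =
      k.pair (ξ (i + 2)) X • ξ i + k.pair (ξ i) X • ξ (i + 2) := by
    have h1 := congrArg (fun Y ↦ ⁅ξ (i + 1), Y⁆) (hsq' X)
    simp only [l0, hadd, hsmul, lie_add, lie_neg, pl, T.lie_succ_self] at h1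
    simp only [hsq'] at h1
    ext x
    have h2 := congrArg (fun Y : VectorFields E M ↦ Y x) h1
    simp only [ContMDiffSection.coe_add, ContMDiffSection.coe_neg, ContMDiffSection.coe_smul,
      Pi.add_apply, Pi.neg_apply, Pi.smul_apply, smul_field_apply,
      PseudoRiemannianMetric.pair_apply, map_smul, smul_apply] at h2 ⊢
    linear_combination (norm := module) (-1 / 2 : ℝ) • h2
  have sq2 (X : VectorFields E M) :
      F (i + 2) (F (i + 2) X) = -X + k.pair (ξ (i + 2)) X • ξ (i + 2) := by
    have h1 := congrArg (fun Y ↦ ⁅ξ (i + 1), Y⁆) (anti X)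
    have a1 := anti ⁅ξ (i + 1), X⁆
    simp only [l0, l2, hadd, hsmul, hsq', lie_add, pl, T.lie_succ_self, T.lie_succ_succ'] at h1
    ext x
    have h2 := congrArg (fun Y : VectorFields E M ↦ Y x) h1
    have a2 := congrArg (fun Y : VectorFields E M ↦ Y x) a1
    simp only [ContMDiffSection.coe_add, ContMDiffSection.coe_neg, ContMDiffSection.coe_smul,
      Pi.add_apply, Pi.neg_apply, Pi.smul_apply, smul_field_apply,
      PseudoRiemannianMetric.pair_apply, map_smul, smul_apply] at h2 a2 ⊢
    linear_combination (norm := module) (-1 / 4 : ℝ) • h2 + (1 / 4 : ℝ) • a2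
  refine ⟨fun x v ↦ ?_, fun x v ↦ ?_⟩ <;> obtain ⟨X, rfl⟩ := exists_vectorField (E := E) x v
  · exact congrArg (fun Y : VectorFields E M ↦ Y x) (sq2 X)
  · exact congrArg (fun Y : VectorFields E M ↦ Y x) (anti X)

lemma sq (T : IsKillingTriple k cov ξ) (i : Fin 3) (x : M) (v : TangentSpace 𝓘(ℝ, E) x) :
    cov (ξ i) x (cov (ξ i) x v) = -v + k.inner x (ξ i x) v • ξ i x := by
  have h2 := (T.sq_and_anticomm_of_sq 0 T.sq_zero).1
  have h1 := (T.sq_and_anticomm_of_sq 2 h2).1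
  fin_cases i
  · exact T.sq_zero x v
  · exact h1 x v
  · exact h2 x v

lemma anticomm (T : IsKillingTriple k cov ξ) (i : Fin 3) (x : M) (v : TangentSpace 𝓘(ℝ, E) x) :
    cov (ξ (i + 1)) x (cov (ξ i) x v) = -cov (ξ i) x (cov (ξ (i + 1)) x v)
      + k.inner x (ξ i x) v • ξ (i + 1) x + k.inner x (ξ (i + 1) x) v • ξ i x := by
  have := (T.sq_and_anticomm_of_sq (i + 1) (T.sq (i + 1))).2 x v
  rw [fin_three_add₁₂] at this
  linear_combination (norm := module) this

end IsKillingTriple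

end KillingTriple

/-! ### The involution determined by a Killing triple -/

section Involution

variable [FiniteDimensional ℝ E] [T2Space M]
  {k : PseudoRiemannianMetric E M} {cov : Connection E M}

variable (k cov) in
/-- The endomorphism field `-(∇ξ₀ ∘ ∇ξ₁ ∘ ∇ξ₂) - η₀ ⊗ ξ₀ - η₂ ⊗ ξ₂`. For a Killing triple it is an
isometric involution, equal to `-1` on the span of the triple; on the orthogonal complement it is
`1` or `-1` according to the sign in `∇ξ₀ ∘ ∇ξ₁ = ± ∇ξ₂`. -/
def involution (ξ : Fin 3 → VectorFields E M) (x : M) :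
    TangentSpace 𝓘(ℝ, E) x →L[ℝ] TangentSpace 𝓘(ℝ, E) x :=
  -(cov (ξ 0) x ∘L cov (ξ 1) x ∘L cov (ξ 2) x) - (k.inner x (ξ 0 x)).smulRight (ξ 0 x)
    - (k.inner x (ξ 2 x)).smulRight (ξ 2 x)

namespace IsKillingTriple

variable {ξ : Fin 3 → VectorFields E M}

/-- The expression defining the involution is invariant under cyclic permutations. -/
lemma involution_eq (T : IsKillingTriple k cov ξ) (i : Fin 3) (x : M)
    (v : TangentSpace 𝓘(ℝ, E) x) :
    involution k cov ξ x v = -cov (ξ i) x (cov (ξ (i + 1)) x (cov (ξ (i + 2)) x v))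
      - k.inner x (ξ i x) v • ξ i x - k.inner x (ξ (i + 2) x) v • ξ (i + 2) x := by
  have step (i : Fin 3) : -cov (ξ i) x (cov (ξ (i + 1)) x (cov (ξ (i + 2)) x v))
      - k.inner x (ξ i x) v • ξ i x - k.inner x (ξ (i + 2) x) v • ξ (i + 2) x =
      -cov (ξ (i + 1)) x (cov (ξ (i + 2)) x (cov (ξ i) x v))
      - k.inner x (ξ (i + 1) x) v • ξ (i + 1) x - k.inner x (ξ i x) v • ξ i x := by
    have a1 := T.anticomm i x (cov (ξ (i + 2)) x v)
    have a2 := T.anticomm (i + 2) x v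
    rw [fin_three_add₂₁] at a2
    have e1 := T.inner_cov (i + 2) x (ξ i x) v
    have e2 := T.inner_cov (i + 2) x (ξ (i + 1) x) v
    rw [(T.cov₂ i x).1, map_neg, neg_apply, neg_inj] at e1
    rw [(T.cov₂ i x).2] at e2
    have e2' : k.inner x (ξ (i + 1) x) (cov (ξ (i + 2)) x v) = -k.inner x (ξ i x) v := by
      linarith
    rw [← e1, e2'] at a1
    have a3 := congrArg (cov (ξ (i + 1)) x) a2
    simp only [map_add, map_neg, map_smul, (T.cov₁ i x).1, (T.cov₁ i x).2] at a3
    linear_combination (norm := module) a3 - a1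
  have h0 : involution k cov ξ x v = -cov (ξ 0) x (cov (ξ 1) x (cov (ξ 2) x v))
      - k.inner x (ξ 0 x) v • ξ 0 x - k.inner x (ξ 2 x) v • ξ 2 x := rfl
  have s0 := step 0
  have s1 := step 1
  fin_cases i
  · exact h0
  · exact h0.trans s0
  · exact (h0.trans s0).trans s1

lemma involution_vertical (T : IsKillingTriple k cov ξ) (i : Fin 3) (x : M) :
    involution k cov ξ x (ξ i x) = -ξ i x := by
  rw [T.involution_eq i, (T.cov₂ i x).1, map_neg, T.cov_self, neg_zero, map_zero, T.unit,
    T.orthogonal _ _ (by simp)]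
  module

/-- The relation `∇ξ_i ∘ ∇ξ_{i+1} = τ ∘ ∇ξ_{i+2} + η_{i+1} ⊗ ξ_i`, where `τ` is the involution. -/
lemma cov_cov (T : IsKillingTriple k cov ξ) (i : Fin 3) (x : M) (v : TangentSpace 𝓘(ℝ, E) x) :
    cov (ξ i) x (cov (ξ (i + 1)) x v) =
      involution k cov ξ x (cov (ξ (i + 2)) x v) + k.inner x (ξ (i + 1) x) v • ξ i x := by
  have e1 := T.inner_cov (i + 2) x (ξ i x) v
  have e2 := T.inner_cov (i + 2) x (ξ (i + 2) x) v
  rw [(T.cov₂ i x).1, map_neg, neg_apply, neg_inj] at e1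
  rw [T.cov_self, map_zero, zero_apply, zero_eq_neg] at e2
  rw [T.involution_eq i, T.sq, ← e1, e2]
  simp only [map_add, map_neg, map_smul, (T.cov₁ i x).2, T.cov_self]
  module

lemma cov_cov_swap (T : IsKillingTriple k cov ξ) (i : Fin 3) (x : M)
    (v : TangentSpace 𝓘(ℝ, E) x) :
    cov (ξ (i + 1)) x (cov (ξ i) x v) =
      -involution k cov ξ x (cov (ξ (i + 2)) x v) + k.inner x (ξ i x) v • ξ (i + 1) x := by
  rw [T.anticomm, T.cov_cov]
  module

lemma involution_cov (T : IsKillingTriple k cov ξ) (i : Fin 3) (x : M)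
    (v : TangentSpace 𝓘(ℝ, E) x) :
    involution k cov ξ x (cov (ξ i) x v) = cov (ξ i) x (involution k cov ξ x v) := by
  have h1 := T.cov_cov (i + 1) x v
  rw [fin_three_add₁₂, fin_three_add₁₁] at h1
  have e1 := T.inner_cov (i + 1) x (ξ i x) (cov (ξ (i + 2)) x v)
  have e2 := T.inner_cov (i + 2) x (ξ (i + 2) x) v
  rw [T.cov_self, map_zero, zero_apply, zero_eq_neg] at e2
  rw [(T.cov₁ i x).1, e2, zero_eq_neg] at e1
  rw [T.involution_eq i x v]
  simp only [map_sub, map_neg, map_smul, T.sq, T.cov_self, T.cov_succ_succ, e1]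
  linear_combination (norm := module) -h1

lemma involution_involution (T : IsKillingTriple k cov ξ) (x : M) (v : TangentSpace 𝓘(ℝ, E) x) :
    involution k cov ξ x (involution k cov ξ x v) = v := by
  have h1 := T.cov_cov 0 x v
  have a1 := T.anticomm 0 x (cov (ξ 1) x v)
  have e1 := T.inner_cov 1 x (ξ 0 x) v
  have e2 := T.inner_cov 1 x (ξ 1 x) v
  have c1 := (T.cov₁ 0 x).1
  have c2 := T.cov_succ_succ 0 x
  have c3 := T.cov_succ 0 x
  simp only [zero_add] at h1 a1 c1 c2 c3
  rw [T.cov_self, map_zero, zero_apply, zero_eq_neg] at e2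
  rw [c1] at e1
  have e1' : k.inner x (ξ 0 x) (cov (ξ 1) x v) = -k.inner x (ξ 2 x) v := by linarith
  rw [e1', e2] at a1
  rw [T.involution_eq 0 x v]
  simp only [zero_add, map_sub, map_neg, map_smul, T.involution_cov, T.involution_vertical]
  have h2 := congrArg (fun w ↦ cov (ξ 0) x (cov (ξ 1) x w)) h1
  have a2 := congrArg (cov (ξ 0) x) a1
  simp only [map_add, map_neg, map_smul, c1, c2, c3, T.sq, T.involution_cov] at h2 a2
  linear_combination (norm := module) h2 - a2

lemma involution_symm (T : IsKillingTriple k cov ξ) (x : M) (v w : TangentSpace 𝓘(ℝ, E) x) :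
    k.inner x (involution k cov ξ x v) w = k.inner x v (involution k cov ξ x w) := by
  have h1 := congrArg (cov (ξ 2) x) (T.cov_cov_swap 0 x w)
  have c := (T.cov₂ 0 x).2
  simp only [zero_add] at c
  simp only [zero_add, map_add, map_neg, map_smul, ← T.involution_cov, T.sq, c,
    T.involution_vertical] at h1
  have h2 := congrArg (k.inner x v) h1
  rw [T.involution_eq 0 x v]
  simp only [zero_add, map_sub, map_neg, map_smul, sub_apply, neg_apply, smul_apply, T.inner_cov,
    map_add, smul_eq_mul, neg_neg] at h2 ⊢
  rw [k.symm x v (ξ 0 x), k.symm x v (ξ 2 x)] at h2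
  linear_combination h2

end IsKillingTriple

end Involution

/-! ### The pseudo 3-Sasakian structure determined by a Killing triple -/

section KillingTripleMetric

variable [FiniteDimensional ℝ E] [T2Space M]
  {k : PseudoRiemannianMetric E M} {cov : Connection E M}

namespace IsKillingTriple

variable {ξ : Fin 3 → VectorFields E M}

/-- The image of a smooth vector field under the involution. -/
def involutionField (T : IsKillingTriple k cov ξ) (X : VectorFields E M) : VectorFields E M :=
  -nabla T.leviCivita (nabla T.leviCivita (nabla T.leviCivita X (ξ 2)) (ξ 1)) (ξ 0)
    - k.pair (ξ 0) X • ξ 0 - k.pair (ξ 2) X • ξ 2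

@[simp]
lemma involutionField_apply (T : IsKillingTriple k cov ξ) (X : VectorFields E M) (x : M) :
    T.involutionField X x = involution k cov ξ x (X x) := rfl

/-- The involution is invariant under the flows of the Killing triple. -/
lemma lie_involutionField (T : IsKillingTriple k cov ξ) (j : Fin 3) (X : VectorFields E M) :
    ⁅ξ j, T.involutionField X⁆ = T.involutionField ⁅ξ j, X⁆ := by
  obtain ⟨i, rfl⟩ : ∃ i, j = i + 1 := ⟨j + 2, (fin_three_add₂₁ j).symm⟩
  let F (j : Fin 3) (X : VectorFields E M) := nabla T.leviCivita X (ξ j)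
  have e (Y : VectorFields E M) : T.involutionField Y =
      -F i (F (i + 1) (F (i + 2) Y)) - k.pair (ξ i) Y • ξ i - k.pair (ξ (i + 2)) Y • ξ (i + 2) := by
    ext x
    exact T.involution_eq i x _
  have hadd (j) (X Y : VectorFields E M) : F j (X + Y) = F j X + F j Y := by
    ext x; simp [F]
  have hsmul (j) (c : ℝ) (X : VectorFields E M) : F j (c • X) = c • F j X := by
    ext x; simp [F]
  have l0 (X) : ⁅ξ (i + 1), F i X⁆ = F i ⁅ξ (i + 1), X⁆ + (-2 : ℝ) • F (i + 2) X :=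
    T.lie_nabla_succ_self i X
  have l1 (X) : ⁅ξ (i + 1), F (i + 1) X⁆ = F (i + 1) ⁅ξ (i + 1), X⁆ :=
    T.lie_nabla_self (i + 1) X
  have l2 (X) : ⁅ξ (i + 1), F (i + 2) X⁆ = F (i + 2) ⁅ξ (i + 1), X⁆ + (2 : ℝ) • F i X :=
    T.lie_nabla_succ i X
  have pl := fun a b X ↦ lie_pair_smul (T.killing (i + 1)) (ξ a) (ξ b) X
  have h1 := congrArg (fun Y ↦ ⁅ξ (i + 1), Y⁆) (e X)
  simp only [l0, l1, l2, hadd, hsmul, lie_sub, lie_neg, pl, T.lie_succ_self,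
    T.lie_succ_succ'] at h1
  rw [h1, e]
  ext x
  -- `∇ξ_{i+2} ∘ ∇ξ_{i+1} ∘ ∇ξ_{i+2} = ∇ξ_i ∘ ∇ξ_{i+1} ∘ ∇ξ_i`
  have q : cov (ξ i) x (cov (ξ (i + 1)) x (cov (ξ i) x (X x))) =
      cov (ξ (i + 2)) x (cov (ξ (i + 1)) x (cov (ξ (i + 2)) x (X x))) := by
    have c1 := congrArg (cov (ξ i) x) (T.cov_cov_swap i x (X x))
    have c2 := T.cov_cov (i + 1) x (X x)
    rw [fin_three_add₁₂, fin_three_add₁₁] at c2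
    have c3 := congrArg (cov (ξ (i + 2)) x) c2
    have c4 := T.anticomm (i + 2) x (X x)
    rw [fin_three_add₂₁] at c4
    have c5 := congrArg (involution k cov ξ x) c4
    simp only [map_add, map_neg, map_smul, ← T.involution_cov, T.involution_vertical, T.cov_succ,
      (T.cov₂ i x).2] at c1 c3 c5
    linear_combination (norm := module) c1 - c3 - c5
  simp only [ContMDiffSection.coe_add, ContMDiffSection.coe_sub, ContMDiffSection.coe_neg,
    ContMDiffSection.coe_smul, Pi.add_apply, Pi.sub_apply, Pi.neg_apply, Pi.smul_apply,
    smul_field_apply, PseudoRiemannianMetric.pair_apply, map_smul, smul_apply, F, nabla_apply]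
  linear_combination (norm := module) (-2 : ℝ) • q

/-- The metric `k(τ ·, ·)`, where `τ` is the involution of the Killing triple. -/
def metric (T : IsKillingTriple k cov ξ) : PseudoRiemannianMetric E M where
  inner x := k.inner x ∘L involution k cov ξ x
  symm x v w := (T.involution_symm x v w).trans (k.symm x _ _)
  nondegenerate x v hv := by
    have h0 : involution k cov ξ x v = 0 := k.nondegenerate x _ hv
    rw [← T.involution_involution x v, h0, map_zero]
  contMDiff := contMDiff_of_apply₂ _ fun X Y ↦ (k.pair (T.involutionField X) Y).contMDiff

lemma metric_apply (T : IsKillingTriple k cov ξ) (x : M) (v w : TangentSpace 𝓘(ℝ, E) x) :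
    T.metric.inner x v w = k.inner x (involution k cov ξ x v) w := rfl

lemma metric_vertical (T : IsKillingTriple k cov ξ) (i : Fin 3) (x : M)
    (v : TangentSpace 𝓘(ℝ, E) x) : T.metric.inner x (ξ i x) v = -k.inner x (ξ i x) v := by
  rw [metric_apply, T.involution_vertical, map_neg, neg_apply]

lemma killing_metric (T : IsKillingTriple k cov ξ) (i : Fin 3) :
    IsKilling T.metric.inner (ξ i) := isKilling_iff.2 fun Y Z x ↦ by
  have e (Y Z : VectorFields E M) : T.metric.pair Y Z = k.pair (T.involutionField Y) Z := rfl
  rw [e, e, e, (T.killing i).D_pair_lie, T.lie_involutionField]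
  rfl

/-- The covariant derivatives of the `ξ i` for the two metrics differ by the involution up to sign,
because the dual one-forms differ by a sign. -/
lemma phi_metric (T : IsKillingTriple k cov ξ) {cov' : Connection E M}
    (H : IsLeviCivita T.metric cov') (i : Fin 3) (x : M) (v : TangentSpace 𝓘(ℝ, E) x) :
    phi cov' (ξ i) x v = involution k cov ξ x (cov (ξ i) x v) := by
  obtain ⟨X, rfl⟩ := exists_vectorField (E := E) x v
  refine sub_eq_zero.1 (T.metric.nondegenerate x _ fun w ↦ ?_)
  obtain ⟨Y, rfl⟩ := exists_vectorField (E := E) x w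
  have h1 := (T.killing i).dPair_eq T.leviCivita X Y x
  have h2 := (T.killing_metric i).dPair_eq H X Y x
  have e (X : VectorFields E M) : T.metric.pair (ξ i) X = -k.pair (ξ i) X :=
    ContMDiffMap.ext fun x ↦ T.metric_vertical i x _
  simp only [dPair, e, D_neg, ContMDiffMap.coe_sub, ContMDiffMap.coe_neg, Pi.sub_apply,
    Pi.neg_apply] at h1 h2
  simp only [cov_apply_eq (cov := cov'), map_neg, neg_apply] at h2
  rw [map_sub, sub_apply, metric_apply T x (involution k cov ξ x _), T.involution_involution]
  linear_combination (1 / 2 : ℝ) * h1 + (1 / 2 : ℝ) * h2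

lemma isContactTriple_metric (T : IsKillingTriple k cov ξ) {cov' : Connection E M}
    (H : IsLeviCivita T.metric cov') : IsContactTriple T.metric cov' ξ where
  leviCivita := H
  killing := T.killing_metric
  timelike i x := by rw [metric_vertical, T.unit]
  orthogonal i j hij x := by rw [metric_vertical, T.orthogonal i j hij, neg_zero]
  phi_comp i x v := by
    rw [T.phi_metric H, T.phi_metric H, T.phi_metric H, ← T.involution_cov,
      T.involution_involution, T.cov_cov, metric_vertical]
    module
  phi_comp_swap i x v := by
    rw [T.phi_metric H, T.phi_metric H, T.phi_metric H, ← T.involution_cov,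
      T.involution_involution, T.cov_cov_swap, metric_vertical]
    module

lemma isPseudoThreeSasakian_metric (T : IsKillingTriple k cov ξ) {cov' : Connection E M}
    (H : IsLeviCivita T.metric cov') : IsPseudoThreeSasakian T.metric cov' ξ :=
  (T.isContactTriple_metric H).isPseudoThreeSasakian fun i x v ↦ by
    rw [T.phi_metric H, T.phi_metric H, ← T.involution_cov, T.involution_involution, T.sq,
      metric_vertical]
    module

/-- The `1`-eigenspaces of the involution. -/
def plus (_T : IsKillingTriple k cov ξ) (x : M) : Submodule ℝ (TangentSpace 𝓘(ℝ, E) x) :=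
  LinearMap.ker (involution k cov ξ x - .id ℝ _).toLinearMap

/-- The orthogonal complement of the span of the triple in the `-1`-eigenspaces of the
involution. -/
def minus (_T : IsKillingTriple k cov ξ) (x : M) : Submodule ℝ (TangentSpace 𝓘(ℝ, E) x) :=
  LinearMap.ker (involution k cov ξ x + .id ℝ _).toLinearMap ⊓
    ⨅ i, LinearMap.ker (k.inner x (ξ i x)).toLinearMap

lemma mem_plus (T : IsKillingTriple k cov ξ) {x : M} {v : TangentSpace 𝓘(ℝ, E) x} :
    v ∈ T.plus x ↔ involution k cov ξ x v = v := by
  simp [plus, sub_eq_zero]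

lemma mem_minus (T : IsKillingTriple k cov ξ) {x : M} {v : TangentSpace 𝓘(ℝ, E) x} :
    v ∈ T.minus x ↔ involution k cov ξ x v = -v ∧ ∀ i, k.inner x (ξ i x) v = 0 := by
  simp [minus, add_eq_zero_iff_eq_neg]

lemma involution_of_mem_vertical (T : IsKillingTriple k cov ξ) {x : M}
    {v : TangentSpace 𝓘(ℝ, E) x} (hv : v ∈ vertical ξ x) : involution k cov ξ x v = -v := by
  have : vertical ξ x ≤ LinearMap.ker (involution k cov ξ x + .id ℝ _).toLinearMap :=
    Submodule.span_le.2 (by rintro _ ⟨i, rfl⟩; simp [T.involution_vertical])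
  simpa [add_eq_zero_iff_eq_neg] using this hv

/-- Eigenvectors of the involution for distinct eigenvalues are orthogonal. -/
lemma inner_eq_zero (T : IsKillingTriple k cov ξ) {x : M} {v w : TangentSpace 𝓘(ℝ, E) x}
    (hv : involution k cov ξ x v = v) (hw : involution k cov ξ x w = -w) :
    k.inner x v w = 0 := by
  have := T.involution_symm x v w
  rw [hv, hw, map_neg] at this
  linarith

lemma isInvariantUnder_plus (T : IsKillingTriple k cov ξ) : IsInvariantUnder ξ T.plus := by
  intro i X hX x
  have e : T.involutionField X = X := by
    ext x
    exact T.mem_plus.1 (hX x)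
  rw [mem_plus, ← lie_apply', ← involutionField_apply T, ← T.lie_involutionField, e]

lemma isInvariantUnder_minus (T : IsKillingTriple k cov ξ) : IsInvariantUnder ξ T.minus := by
  intro i X hX x
  have e : T.involutionField X = -X := by
    ext x
    exact (T.mem_minus.1 (hX x)).1
  have e2 (j : Fin 3) : k.pair (ξ j) X = 0 := ContMDiffMap.ext fun x ↦ (T.mem_minus.1 (hX x)).2 j
  rw [mem_minus, ← lie_apply', ← involutionField_apply T, ← T.lie_involutionField, e, lie_neg]
  refine ⟨rfl, fun j ↦ ?_⟩
  have h1 := congrArg (fun f : Functions E M ↦ f x) ((T.killing i).D_pair_lie (ξ j) X)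
  obtain ⟨c, l, hc⟩ : ∃ (c : ℝ) (l : Fin 3), ⁅ξ i, ξ j⁆ = c • ξ l := by
    rcases fin_three_cases i j with rfl | rfl | rfl
    · exact ⟨0, j, by simp⟩
    · exact ⟨_, _, T.lie_succ i⟩
    · exact ⟨_, _, T.lie_succ_succ i⟩
  have e3 := (T.mem_minus.1 (hX x)).2 l
  rw [e2, D_eq_zero_of_const (c := 0) _ fun x ↦ rfl, hc] at h1
  simpa [e3] using h1.symm

/-- A Killing triple of a Riemannian metric determines a weakly K-contact 3-structure: `D₊` and
`D₋ ⊕ V` are the eigenbundles of the involution. -/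
def weaklyKContactThreeStructure {g : RiemannianMetric E M}
    (T : IsKillingTriple (RiemannianMetric.toPseudo g) cov ξ) :
    WeaklyKContactThreeStructure g where
  ξ := ξ
  h := T.metric
  cov := KContact.leviCivita T.metric
  pseudoThreeSasakian := T.isPseudoThreeSasakian_metric (isLeviCivita_leviCivita _)
  Dpos := T.plus
  Dneg := T.minus
  span x := by
    refine eq_top_iff.2 fun v _ ↦ ?_
    let p := (1 / 2 : ℝ) • (v + involution (RiemannianMetric.toPseudo g) cov ξ x v)
    let q := (1 / 2 : ℝ) • (v - involution (RiemannianMetric.toPseudo g) cov ξ x v)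
    let u := ∑ i, (RiemannianMetric.toPseudo g).inner x (ξ i x) v • ξ i x
    have hu : u ∈ vertical ξ x :=
      Submodule.sum_mem _ fun i _ ↦ Submodule.smul_mem _ _ (Submodule.subset_span ⟨i, rfl⟩)
    have hp : p ∈ T.plus x := T.mem_plus.2 (by simp [p, T.involution_involution, add_comm])
    have hq : q - u ∈ T.minus x := by
      refine T.mem_minus.2 ⟨?_, fun j ↦ ?_⟩
      · rw [map_sub, T.involution_of_mem_vertical hu]
        simp only [q, map_smul, map_sub, T.involution_involution]
        module
      · have h1 := T.involution_symm x (ξ j x) v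
        rw [T.involution_vertical, map_neg, neg_apply] at h1
        have h2 : (RiemannianMetric.toPseudo g).inner x (ξ j x) u =
            (RiemannianMetric.toPseudo g).inner x (ξ j x) v := by
          simp only [u, map_sum, map_smul, smul_eq_mul]
          rw [Finset.sum_eq_single j (fun i _ hi ↦ by rw [T.orthogonal j i hi.symm, mul_zero])
            (by simp), T.unit, mul_one]
        rw [map_sub, h2]
        simp only [q, map_smul, map_sub, ← h1, smul_eq_mul]
        ring
    have hv : v = p + (q - u) + u := by
      simp only [p, q]
      module
    rw [hv]
    exact Submodule.add_mem_sup (Submodule.add_mem_sup hp hq) hu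
  orthogonal x v hv w hw := by
    rw [metric_apply, T.mem_plus.1 hv, T.inner_eq_zero (T.mem_plus.1 hv) (T.mem_minus.1 hw).1]
  orthogonal_pos x v hv w hw := by
    rw [metric_apply, T.mem_plus.1 hv,
      T.inner_eq_zero (T.mem_plus.1 hv) (T.involution_of_mem_vertical hw)]
  orthogonal_neg x v hv w hw := by
    have : vertical ξ x ≤ LinearMap.ker (T.metric.inner x v).toLinearMap := by
      refine Submodule.span_le.2 ?_
      rintro _ ⟨i, rfl⟩
      have := (T.mem_minus.1 hv).2 i
      simp only [SetLike.mem_coe, LinearMap.mem_ker, ContinuousLinearMap.coe_coe]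
      rw [T.metric.symm, metric_vertical, this, neg_zero]
    exact this hw
  pos x v hv hv0 := by
    rw [metric_apply, T.mem_plus.1 hv]
    exact g.pos x v hv0
  neg x v hv hv0 := by
    rw [metric_apply, (T.mem_minus.1 hv).1, map_neg, neg_apply, neg_lt_zero]
    exact g.pos x v hv0
  invariant_pos := T.isInvariantUnder_plus
  invariant_neg := T.isInvariantUnder_minus
  phi_pos i x v hv := by
    rw [T.phi_metric (isLeviCivita_leviCivita _), T.involution_cov, T.mem_plus.1 hv, mem_plus,
      T.involution_cov, T.mem_plus.1 hv]
  phi_neg i x v hv := by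
    rw [T.phi_metric (isLeviCivita_leviCivita _), T.involution_cov, (T.mem_minus.1 hv).1, mem_minus]
    refine ⟨?_, fun j ↦ ?_⟩
    · rw [T.involution_cov, map_neg, map_neg, (T.mem_minus.1 hv).1, map_neg]
    · have h1 := T.inner_cov i x (ξ j x) (-v)
      obtain ⟨c, l, hc⟩ : ∃ (c : ℝ) (l : Fin 3), cov (ξ i) x (ξ j x) = c • ξ l x := by
        rcases fin_three_cases i j with rfl | rfl | rfl
        · exact ⟨0, j, by simp [T.cov_self]⟩
        · exact ⟨-1, _, by simp [T.cov_succ i]; rfl⟩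
        · exact ⟨1, _, by simp [T.cov_succ_succ i]; rfl⟩
      have e3 := (T.mem_minus.1 hv).2 l
      rw [hc, map_smul, smul_apply, map_neg, e3, neg_zero, smul_zero] at h1
      linarith
  metric_pos x v hv w := by
    rw [metric_apply, T.mem_plus.1 hv]
    rfl
  metric_neg x v hv w := by
    have e : involution (RiemannianMetric.toPseudo g) cov ξ x v = -v := by
      obtain ⟨a, ha, b, hb, rfl⟩ := Submodule.mem_sup.1 hv
      rw [map_add, (T.mem_minus.1 ha).1, T.involution_of_mem_vertical hb, neg_add]
    rw [metric_apply, e, map_neg, neg_apply, neg_neg]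
    rfl

end IsKillingTriple

end KillingTripleMetric

/-! ### Killing fields of constant length and 3-structures -/

section Main

variable [FiniteDimensional ℝ E] [T2Space M]

/-- On a K-contact manifold, a unit length field `A` in `𝔤₂` gives the Killing triple
`ξ, A, ½ L_ξ A`. -/
lemma IsKContact.exists_isKillingTriple {g : RiemannianMetric E M} {ξ A : VectorFields E M}
    {φ : Π x : M, TangentSpace 𝓘(ℝ, E) x →L[ℝ] TangentSpace 𝓘(ℝ, E) x} (hK : IsKContact g ξ φ)
    (hA : A ∈ g₂ g ξ) (h1 : ∀ x, g.inner x (A x) (A x) = 1) :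
    IsKillingTriple (RiemannianMetric.toPseudo g) (leviCivita (RiemannianMetric.toPseudo g))
      ![ξ, A, (1 / 2 : ℝ) • ⁅ξ, A⁆] := by
  have H := isLeviCivita_leviCivita (RiemannianMetric.toPseudo g)
  obtain ⟨kA, hA2⟩ := mem_g₂_iff.1 hA
  have kξ : IsKilling (RiemannianMetric.toPseudo g).inner ξ := hK.killing
  have hξ : ∀ x, (RiemannianMetric.toPseudo g).pair ξ ξ x = 1 := hK.unit
  have hAA : ∀ x, (RiemannianMetric.toPseudo g).pair A A x = 1 := h1
  set B := (1 / 2 : ℝ) • ⁅ξ, A⁆ with hB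
  have kB : IsKilling (RiemannianMetric.toPseudo g).inner B := (kξ.lie kA).smul _
  have l1 : ⁅ξ, A⁆ = (2 : ℝ) • B := by rw [hB, smul_smul]; norm_num
  have l2 : ⁅ξ, B⁆ = (-2 : ℝ) • A := by rw [hB, lie_smul, hA2, smul_smul]; norm_num
  have o1 (x : M) : (RiemannianMetric.toPseudo g).pair ξ A x = 0 := by
    have := kB.pair_lie_self hξ x
    simpa [l2] using this
  have o2 (x : M) : (RiemannianMetric.toPseudo g).pair ξ B x = 0 := by
    have := kA.pair_lie_self hξ x
    simpa [l1] using this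
  have o3 (x : M) : (RiemannianMetric.toPseudo g).pair A B x = 0 := by
    have := kξ.pair_lie_self hAA x
    rw [← lie_skew, l1] at this
    simpa using this
  have hBB (x : M) : (RiemannianMetric.toPseudo g).pair B B x = 1 := by
    have h2 := congrArg (fun f : Functions E M ↦ f x) (kξ.D_pair_lie A B)
    rw [l1, l2, D_eq_zero_of_const ξ o3] at h2
    have h3 := hAA x
    simp at h2 h3 ⊢
    linarith
  -- `⁅A, B⁆ - 2ξ` commutes with `ξ` and is orthogonal to it, so it lies in `𝔤₀ ∩ 𝔤₂`
  have l3 : ⁅A, B⁆ = (2 : ℝ) • ξ := by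
    have o (x : M) : (RiemannianMetric.toPseudo g).pair ξ (⁅A, B⁆ - (2 : ℝ) • ξ) x = 0 := by
      have h2 := congrArg (fun f : Functions E M ↦ f x) (kA.D_pair_lie ξ B)
      rw [D_eq_zero_of_const A o2, ← lie_skew, l1] at h2
      have h3 := hBB x
      have h4 := hξ x
      simp at h2 h3 h4 ⊢
      linarith
    have h2 := kξ.lie_lie_of_orthogonal H ((kA.lie kB).sub (kξ.smul 2)) hξ (hK.nabla_nabla H) o
    have h3 : ⁅ξ, ⁅A, B⁆ - (2 : ℝ) • ξ⁆ = 0 := by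
      rw [lie_sub, leibniz_lie, l1, l2]
      simp
    rw [h3, lie_zero] at h2
    exact sub_eq_zero.1 ((smul_eq_zero.1 h2.symm).resolve_left (by norm_num))
  refine ⟨H, ?_, ?_, ?_, ?_, ?_⟩
  · intro i
    fin_cases i
    exacts [kξ, kA, kB]
  · intro i
    fin_cases i
    exacts [hξ, hAA, hBB]
  · have sym (X Y : VectorFields E M)
        (h : ∀ x, (RiemannianMetric.toPseudo g).pair X Y x = 0) (x : M) :
        (RiemannianMetric.toPseudo g).pair Y X x = 0 := by
      rw [PseudoRiemannianMetric.pair_comm, h]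
    intro i j hij
    fin_cases i <;> fin_cases j
    exacts [(hij rfl).elim, o1, o2, sym _ _ o1, (hij rfl).elim, o3, sym _ _ o2, sym _ _ o3,
      (hij rfl).elim]
  · intro i
    fin_cases i
    · exact l1
    · exact l3
    · change ⁅B, ξ⁆ = (2 : ℝ) • A
      rw [← lie_skew, l2, neg_smul, neg_neg]
  · intro x v
    have := hK.phi_sq x v
    rwa [hK.phi_eq H, hK.phi_eq H] at this

theorem IsKContact.exists_weaklyKContactThreeStructure [Nonempty M] {g : RiemannianMetric E M}
    {ξ A : VectorFields E M} {φ : Π x : M, TangentSpace 𝓘(ℝ, E) x →L[ℝ] TangentSpace 𝓘(ℝ, E) x}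
    (hK : IsKContact g ξ φ) (hA : A ∈ g₂ g ξ) (hA0 : A ≠ 0) (hc : HasConstantLength g A) :
    ∃ S : WeaklyKContactThreeStructure g, S.ξ 0 = ξ := by
  obtain ⟨c, hc⟩ := hc
  have hpos : 0 < c := by
    obtain ⟨x, hx⟩ : ∃ x, A x ≠ 0 := by
      by_contra! h0
      exact hA0 (ContMDiffSection.ext h0)
    rw [← hc x]
    exact g.pos x _ hx
  refine ⟨(hK.exists_isKillingTriple ((g₂ g ξ).smul_mem (√c)⁻¹ hA)
    fun x ↦ ?_).weaklyKContactThreeStructure, rfl⟩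
  simp only [ContMDiffSection.coe_smul, Pi.smul_apply, map_smul, smul_apply, hc, smul_eq_mul]
  rw [← mul_assoc, ← mul_inv, Real.mul_self_sqrt hpos.le, inv_mul_cancel₀ hpos.ne']

namespace IsContactTriple

variable {h : PseudoRiemannianMetric E M} {cov : Connection E M} {ξ : Fin 3 → VectorFields E M}

lemma lie_succ (T : IsContactTriple h cov ξ) (i : Fin 3) :
    ⁅ξ i, ξ (i + 1)⁆ = (2 : ℝ) • ξ (i + 2) := by
  have e := T.phi_succ_succ (i + 1)
  rw [fin_three_add₁₂, fin_three_add₁₁] at e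
  ext x
  rw [← nabla_sub_nabla T.leviCivita]
  simp only [ContMDiffSection.coe_sub, Pi.sub_apply, nabla_apply, cov_apply_eq, T.phi_succ, e,
    ContMDiffSection.coe_smul, Pi.smul_apply]
  module

lemma lie_succ_succ (T : IsContactTriple h cov ξ) (i : Fin 3) :
    ⁅ξ i, ξ (i + 2)⁆ = (-2 : ℝ) • ξ (i + 1) := by
  have := T.lie_succ (i + 2)
  rw [fin_three_add₂₁, fin_three_add₂₂] at this
  rw [← lie_skew, this, neg_smul]

lemma lie_mem_vertical (T : IsContactTriple h cov ξ) (i j : Fin 3) (x : M) :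
    ⁅ξ i, ξ j⁆ x ∈ vertical ξ x := by
  rcases fin_three_cases i j with rfl | rfl | rfl
  · rw [lie_self]
    exact Submodule.zero_mem _
  · rw [T.lie_succ]
    exact Submodule.smul_mem _ _ (Submodule.subset_span ⟨_, rfl⟩)
  · rw [T.lie_succ_succ]
    exact Submodule.smul_mem _ _ (Submodule.subset_span ⟨_, rfl⟩)

lemma add_sum_eq_zero (T : IsContactTriple h cov ξ) {x : M} {v : TangentSpace 𝓘(ℝ, E) x}
    (hv : v ∈ vertical ξ x) : v + ∑ i, h.inner x (ξ i x) v • ξ i x = 0 := by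
  induction hv using Submodule.span_induction with
  | mem v hv =>
    obtain ⟨j, rfl⟩ := hv
    simp [T.inner_eq_ite]
  | zero => simp
  | add v w _ _ hv hw =>
    simp only [map_add, add_smul, Finset.sum_add_distrib]
    linear_combination (norm := module) hv + hw
  | smul c v _ hv =>
    simp only [map_smul, smul_eq_mul, mul_smul, ← Finset.smul_sum, ← smul_add, hv, smul_zero]

end IsContactTriple

namespace WeaklyKContactThreeStructure

variable {g : RiemannianMetric E M}

lemma isContactTriple (S : WeaklyKContactThreeStructure g) : IsContactTriple S.h S.cov S.ξ :=
  S.pseudoThreeSasakian.isContactTriple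

/-- The distribution `D₋ ⊕ V` is invariant under the vector fields `ξ i`. -/
lemma lie_mem (S : WeaklyKContactThreeStructure g) (i : Fin 3) {X : VectorFields E M}
    (hX : ∀ x, X x ∈ S.Dneg x ⊔ vertical S.ξ x) (x : M) :
    ⁅S.ξ i, X⁆ x ∈ S.Dneg x ⊔ vertical S.ξ x := by
  have T := S.isContactTriple
  -- the projection of `X` to `D₋`
  let Y : VectorFields E M := X + ∑ j, S.h.pair (S.ξ j) X • S.ξ j
  have hY (y : M) : Y y ∈ S.Dneg y := by
    obtain ⟨a, ha, b, hb, hab⟩ := Submodule.mem_sup.1 (hX y)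
    have h1 : Y y = X y + ∑ j, S.h.inner y (S.ξ j y) (X y) • S.ξ j y := by
      simp [Y, Fin.sum_univ_three]
    have h2 (j : Fin 3) : S.h.inner y (S.ξ j y) a = 0 := by
      rw [S.h.symm]
      exact S.orthogonal_neg y a ha _ (Submodule.subset_span ⟨j, rfl⟩)
    simp only [← hab, map_add, h2, zero_add, add_assoc, T.add_sum_eq_zero hb, add_zero] at h1
    rwa [h1]
  have hXY : X = Y - ∑ j, S.h.pair (S.ξ j) X • S.ξ j := (add_sub_cancel_right _ _).symm
  have hj (j : Fin 3) : ⁅S.ξ i, S.h.pair (S.ξ j) X • S.ξ j⁆ x ∈ vertical S.ξ x := by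
    rw [lie_smul_field]
    exact Submodule.add_mem _ (Submodule.smul_mem _ _ (Submodule.subset_span ⟨j, rfl⟩))
      (Submodule.smul_mem _ _ (T.lie_mem_vertical i j x))
  rw [hXY, lie_sub]
  refine Submodule.sub_mem _ (Submodule.mem_sup_left (S.invariant_neg i Y hY x))
    (Submodule.mem_sup_right ?_)
  rw [Fin.sum_univ_three, lie_add, lie_add]
  exact Submodule.add_mem _ (Submodule.add_mem _ (hj 0) (hj 1)) (hj 2)

/-- Every smooth vector field is the sum of smooth sections of `D₊` and of `D₋ ⊕ V`. -/
lemma exists_add_eq (S : WeaklyKContactThreeStructure g) (X : VectorFields E M) :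
    ∃ P N : VectorFields E M, (∀ x, P x ∈ S.Dpos x) ∧
      (∀ x, N x ∈ S.Dneg x ⊔ vertical S.ξ x) ∧ P + N = X := by
  have dec (x : M) : ∃ p ∈ S.Dpos x, ∃ n ∈ S.Dneg x ⊔ vertical S.ξ x, p + n = X x :=
    Submodule.mem_sup.1 (by rw [← sup_assoc, S.span]; trivial)
  choose p hp n hn hpn using dec
  -- the section `p - n` is smooth because `g(p - n, ·) = h(X, ·)`
  let Y : VectorFields E M := ofInner (RiemannianMetric.toPseudo g) (fun x ↦ p x - n x) fun Z ↦
    (S.h.pair X Z).contMDiff.congr fun x ↦ by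
      change g.inner x (p x - n x) (Z x) = S.h.inner x (X x) (Z x)
      rw [← hpn, map_sub, sub_apply, S.metric_pos x _ (hp x), S.metric_neg x _ (hn x), map_add,
        add_apply, sub_neg_eq_add]
  have hY (x : M) : Y x = p x - n x := rfl
  refine ⟨(1 / 2 : ℝ) • (X + Y), (1 / 2 : ℝ) • (X - Y), fun x ↦ ?_, fun x ↦ ?_, ?_⟩
  · have : ((1 / 2 : ℝ) • (X + Y)) x = p x := by
      simp only [ContMDiffSection.coe_smul, Pi.smul_apply, ContMDiffSection.coe_add, Pi.add_apply,
        hY, ← hpn]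
      module
    rw [this]
    exact hp x
  · have : ((1 / 2 : ℝ) • (X - Y)) x = n x := by
      simp only [ContMDiffSection.coe_smul, Pi.smul_apply, ContMDiffSection.coe_sub, Pi.sub_apply,
        hY, ← hpn]
      module
    rw [this]
    exact hn x
  · module

/-- The fields `ξ i` are Killing for `g`, because they are Killing for `h` and preserve the
decomposition of the tangent bundle along which the sign of `h` is changed. -/
lemma killing (S : WeaklyKContactThreeStructure g) (i : Fin 3) : S.ξ i ∈ iso g := by
  refine mem_iso_iff.2 (isKilling_iff.2 fun Y Z x ↦ ?_)
  obtain ⟨P, N, hP, hN, rfl⟩ := S.exists_add_eq Y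
  have e {P N : VectorFields E M} (hP : ∀ x, P x ∈ S.Dpos x)
      (hN : ∀ x, N x ∈ S.Dneg x ⊔ vertical S.ξ x) (Z : VectorFields E M) :
      (RiemannianMetric.toPseudo g).pair (P + N) Z = S.h.pair P Z - S.h.pair N Z := by
    ext x
    change g.inner x (P x + N x) (Z x) = S.h.inner x (P x) (Z x) - S.h.inner x (N x) (Z x)
    rw [map_add, add_apply, S.metric_pos x _ (hP x), S.metric_neg x _ (hN x), sub_eq_add_neg]
  rw [lie_add, e hP hN, e hP hN, e (S.invariant_pos i P hP) (S.lie_mem i hN), D_sub,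
    (S.isContactTriple.killing i).D_pair_lie, (S.isContactTriple.killing i).D_pair_lie]
  simp only [ContMDiffMap.coe_add, ContMDiffMap.coe_sub, Pi.add_apply, Pi.sub_apply]
  ring

lemma mem_g₂ (S : WeaklyKContactThreeStructure g) : S.ξ 1 ∈ g₂ g (S.ξ 0) := by
  refine mem_g₂_iff.2 ⟨S.killing 1, ?_⟩
  have h1 := S.isContactTriple.lie_succ 0
  have h2 := S.isContactTriple.lie_succ_succ 0
  simp only [zero_add] at h1 h2
  rw [h1, lie_smul, h2, smul_smul]
  norm_num

lemma inner_self (S : WeaklyKContactThreeStructure g) (i : Fin 3) (x : M) :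
    g.inner x (S.ξ i x) (S.ξ i x) = 1 := by
  rw [S.metric_neg x _ (Submodule.mem_sup_right (Submodule.subset_span ⟨i, rfl⟩)),
    S.isContactTriple.timelike, neg_neg]

lemma exists_mem_g₂ [Nonempty M] (S : WeaklyKContactThreeStructure g) :
    ∃ A ∈ g₂ g (S.ξ 0), A ≠ 0 ∧ HasConstantLength g A := by
  refine ⟨S.ξ 1, S.mem_g₂, fun h0 ↦ ?_, 1, S.inner_self 1⟩
  obtain ⟨x⟩ := ‹Nonempty M›
  have := S.inner_self 1 x
  rw [h0] at this
  simp at this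

end WeaklyKContactThreeStructure

end Main

end KContact

end

theorem mainTheorem2 {E : Type*} [NormedAddCommGroup E] [NormedSpace ℝ E] [FiniteDimensional ℝ E]
    {M : Type*} [TopologicalSpace M] [T2Space M] [CompactSpace M] [Nonempty M]
    [ChartedSpace E M] [IsManifold 𝓘(ℝ, E) ∞ M]
    (g : KContact.RiemannianMetric E M) (ξ₁ : KContact.VectorFields E M)
    (φ₁ : Π x : M, TangentSpace 𝓘(ℝ, E) x →L[ℝ] TangentSpace 𝓘(ℝ, E) x)
    (hK : KContact.IsKContact g ξ₁ φ₁) :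
    (Disjoint (KContact.g₀ g ξ₁) (KContact.g₂ g ξ₁) ∧
      KContact.g₀ g ξ₁ ⊔ KContact.g₂ g ξ₁ = KContact.iso g) ∧
    ((∃ A ∈ KContact.g₂ g ξ₁, A ≠ 0 ∧ KContact.HasConstantLength g A) ↔
      ∃ S : KContact.WeaklyKContactThreeStructure g, S.ξ 0 = ξ₁) := by
  refine ⟨⟨KContact.IsKContact.disjoint, hK.sup_eq_iso⟩, fun ⟨A, hA, hA0, hc⟩ ↦ ?_, ?_⟩
  · exact hK.exists_weaklyKContactThreeStructure hA hA0 hc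
  · rintro ⟨S, rfl⟩
    exact S.exists_mem_g₂
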